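/- Let $n\ge 0$ and let $K$ be a centrally symmetric convex $(2n+4)$-gon in the plane with center $o$. A triangulation of $K$ (a maximal set of pairwise non-crossing diagonals) that is centrally symmetric with respect to $o$ consists of one central diagonal, passing through $o$, and $n$ centrally symmetric pairs of non-central diagonals. A colored triangulation of $K$ is a centrally symmetric triangulation together with a coloring of its non-central diagonals by $n$ given colors such that two of them have the same color if and only if they are equal or form a centrally symmetric pair; the central diagonal is not colored and is assigned an extra color $c^*$. Flipping a diagonal $d$ of a triangulation means replacing $d$ by the other diagonal of the convex quadrilateral formed by the two triangles that have $d$ as an edge. A flip of a colored triangulation flips either the central diagonal (a flip with color $c^*$), or both diagonals of a centrally symmetric pair of color $c$, which gives a pair of diagonals of the same color $c$ (a flip with color $c$); all other diagonals and colors stay the same. The colorful exchange graph $\mathcal H^c_n$ is the graph whose vertices are the colored triangulations of $K$, two of them being adjacent if and only if one is obtained from the other by a flip. For a set $C$ of colors from the $n+1$ colors (including $c^*$) and a colored triangulation $t$, let $(C,t)$ be the set of all colored triangulations obtained from $t$ by sequences of flips with colors in $C$. Let $\mathcal Z^c_n$ be the set consisting of the empty set and all the sets $(C,t)$, partially ordered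 by inclusion. Theorem. $\mathcal Z^c_n$ (the colorful $(n+1)$-cyclohedron) is a simple abstract polytope of rank $n+1$, in which $(C,t)$ is a face of rank $|C|$, and $t\mapsto\{t\}$ is an isomorphism from $\mathcal H^c_n$ onto the $1$-skeleton of $\mathcal Z^c_n$. Here an abstract polytope of rank $m$ is a partially ordered set with a strictly monotone rank function with range $\{-1,0,\dots,m\}$, with a least face of rank $-1$ and a greatest face of rank $m$, such that each flag (maximal chain) has exactly $m+2$ faces; any two flags $\Phi,\Psi$ can be joined by a sequence of flags that all contain $\Phi\cap\Psi$, consecutive ones differing in exactly one face; and whenever $F<G$ have ranks $j-1$ and $j+1$ there are exactly two faces $H$ of rank $j$ with $F<H<G$. It is simple if for each face $F$ of rank $0$ the poset $\{H : H\ge F\}$ is isomorphic to the face lattice of an $(m-1)$-simplex. Its $1$-skeleton is the graph of its faces of rank $0$, two distinct ones being adjacent if they lie on a common face of rank $1$. -/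

import Mathlib

/-!
Flips color the edges of the exchange graph in such a way that every vertex is on exactly one edge
of each color, and that an edge of color `c` cannot be bypassed by a path without the color `c`,
since flips of other colors keep the diagonals of color `c`. The graph is connected: a triangulation
can be flipped to a fan, and two colors in a fan are interchanged by the five flips in a pentagon.

For any graph with such an edge coloring, the connected components of the subgraphs with edges of
given colors form a simple abstract polytope: the components containing a given vertex are in
bijection with the sets of colors, which gives the diamond condition and simplicity, and the strong
connectedness of flags follows from the connectedness of the components by induction on the number
of colors that are left free.
-/

/-! ## Abstract polytopes -/

/-- Two flags are adjacent if they differ by exactly one face. -/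
def FlagAdjacent {P : Type*} [PartialOrder P] (Φ Ψ : Flag P) : Prop :=
  ((Φ : Set P) \ Ψ).ncard = 1 ∧ ((Ψ : Set P) \ Φ).ncard = 1

/-- The partially ordered set `P`, with rank function `rank`, is an abstract polytope of rank `m`.
Flags are maximal chains. -/
structure IsAbstractPolytope (P : Type*) [PartialOrder P] (m : ℕ) (rank : P → ℤ) : Prop where
  rank_strictMono : StrictMono rank
  rank_range : Set.range rank = Set.Icc (-1) (m : ℤ)
  exists_least : ∃ F : P, rank F = -1 ∧ ∀ G, F ≤ G
  exists_greatest : ∃ F : P, rank F = m ∧ ∀ G, G ≤ F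
  flag_card : ∀ Φ : Flag P, (Φ : Set P).ncard = m + 2
  /-- Strong flag-connectedness: any two flags are joined by a sequence of successively adjacent
  flags, all of which contain the intersection of the two given ones. -/
  strongly_flag_connected : ∀ Φ Ψ : Flag P,
    Relation.ReflTransGen
      (fun A B : Flag P => FlagAdjacent A B ∧
        (Φ : Set P) ∩ Ψ ⊆ A ∧ (Φ : Set P) ∩ Ψ ⊆ B) Φ Ψ
  diamond : ∀ (j : ℤ) (F G : P), rank F = j - 1 → rank G = j + 1 → F < G →
    {H : P | rank H = j ∧ F < H ∧ H < G}.ncard = 2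

/-- A polytope of rank `m ≥ 1` is simple if the vertex-figure at each vertex `F`, that is the section
of all faces `H ≥ F`, is isomorphic to the `(m - 1)`-simplex, whose faces are the subsets of
a set of `m` vertices. -/
def IsSimplePolytope (P : Type*) [PartialOrder P] (m : ℕ) (rank : P → ℤ) : Prop :=
  ∀ F : P, rank F = 0 → Nonempty (Set.Ici F ≃o Finset (Fin m))

/-- The `1`-skeleton: the graph of the faces of rank `0`, where two distinct ones are adjacent
if they lie on a common face of rank `1`. -/
def oneSkeleton {P : Type*} [PartialOrder P] (rank : P → ℤ) :
    SimpleGraph {F : P // rank F = 0} where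
  Adj F G := F ≠ G ∧ ∃ E : P, rank E = 1 ∧ F.1 ≤ E ∧ G.1 ≤ E
  symm := ⟨fun _ _ h => ⟨h.1.symm, h.2.imp fun _ hE => ⟨hE.1, hE.2.2, hE.2.1⟩⟩⟩
  loopless := ⟨fun _ h => h.1 rfl⟩

/-! ## Centrally symmetric convex polygons -/

/-- The index of the vertex opposite to the `i`-th vertex of a `(2n+4)`-gon. -/
def antipode {n : ℕ} (i : Fin (2 * n + 4)) : Fin (2 * n + 4) :=
  ⟨(i + (n + 2)) % (2 * n + 4), Nat.mod_lt _ (by omega)⟩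

/-- A centrally symmetric (strictly) convex `(2n+4)`-gon in the plane. Its vertices are labelled in
counterclockwise order: any three of them, taken in the order of their labels, form a positively
oriented triangle. -/
structure SymmetricPolygon (n : ℕ) where
  vertex : Fin (2 * n + 4) → ℝ × ℝ
  center : ℝ × ℝ
  convex : ∀ i j k, i < j → j < k →
    0 < ((vertex j).1 - (vertex i).1) * ((vertex k).2 - (vertex i).2)
      - ((vertex j).2 - (vertex i).2) * ((vertex k).1 - (vertex i).1)
  symmetric : ∀ i, vertex (antipode i) = center + (center - vertex i)

/-- A pair of consecutive vertices, i.e. a boundary edge of the polygon. -/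
def IsSide {n : ℕ} (d : Sym2 (Fin (2 * n + 4))) : Prop := ∃ i, d = s(i, i + 1)

/-- A pair of distinct, non-consecutive vertices. -/
def IsDiagonal {n : ℕ} (d : Sym2 (Fin (2 * n + 4))) : Prop := ¬ d.IsDiag ∧ ¬ IsSide d

/-- The image of a pair of vertices under the central symmetry. -/
def opposite {n : ℕ} (d : Sym2 (Fin (2 * n + 4))) : Sym2 (Fin (2 * n + 4)) := d.map antipode

namespace SymmetricPolygon

variable {n : ℕ} (K : SymmetricPolygon n)

/-- The open line segment between two vertices of the polygon. -/
def segmentOf (d : Sym2 (Fin (2 * n + 4))) : Set (ℝ × ℝ) :=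
  {x | ∃ i j, d = s(i, j) ∧ x ∈ openSegment ℝ (K.vertex i) (K.vertex j)}

/-- Distinct segments `d` and `e` cross if they meet in a relative interior point of both. -/
def Crosses (d e : Sym2 (Fin (2 * n + 4))) : Prop :=
  d ≠ e ∧ (K.segmentOf d ∩ K.segmentOf e).Nonempty

/-- `d` passes through the center of the polygon. -/
def IsCentral (d : Sym2 (Fin (2 * n + 4))) : Prop := K.center ∈ K.segmentOf d

/-- A triangulation of the polygon, given by its set of diagonals: a maximal set of pairwise
non-crossing diagonals. -/
structure IsTriangulation (t : Finset (Sym2 (Fin (2 * n + 4)))) : Prop where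
  isDiagonal : ∀ d ∈ t, IsDiagonal d
  not_crosses : ∀ d ∈ t, ∀ e ∈ t, ¬ K.Crosses d e
  maximal : ∀ d, IsDiagonal d → (∀ e ∈ t, ¬ K.Crosses d e) → d ∈ t

/-- A colored centrally symmetric triangulation. The `n` colors are the elements of `Fin n`.
Precisely the non-central diagonals of the triangulation carry a color (`color d = none` expresses
that `d` is uncolored), and two of them have the same color if and only if they are equal or form
a centrally symmetric pair. -/
structure ColoredTriangulation where
  diagonals : Finset (Sym2 (Fin (2 * n + 4)))
  isTriangulation : K.IsTriangulation diagonals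
  symmetric : ∀ d ∈ diagonals, opposite d ∈ diagonals
  color : Sym2 (Fin (2 * n + 4)) → Option (Fin n)
  color_eq_none_iff : ∀ d, color d = none ↔ (d ∉ diagonals ∨ K.IsCentral d)
  color_eq_iff : ∀ d ∈ diagonals, ∀ e ∈ diagonals, ¬ K.IsCentral d → ¬ K.IsCentral e →
    (color d = color e ↔ (d = e ∨ d = opposite e))

/-- Flipping the diagonal `d` of the triangulation `t` gives `d'`: the diagonal `d = ik` is
a common edge of two triangles `ijk` and `ikl` of `t`, on different sides of `d`, and `d' = jl` is
the other diagonal of the quadrilateral `ijkl` formed by them. -/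
def FlipsTo (t : Finset (Sym2 (Fin (2 * n + 4)))) (d d' : Sym2 (Fin (2 * n + 4))) : Prop :=
  d ∈ t ∧ ∃ i j k l, d = s(i, k) ∧ d' = s(j, l) ∧ K.Crosses d d' ∧
    (s(i, j) ∈ t ∨ IsSide s(i, j)) ∧ (s(j, k) ∈ t ∨ IsSide s(j, k)) ∧
    (s(k, l) ∈ t ∨ IsSide s(k, l)) ∧ (s(l, i) ∈ t ∨ IsSide s(l, i))

variable {K}

/-- `Flip c t t'`: the colored triangulation `t'` is obtained from `t` by the color-preserving flip
of the diagonals of color `c`. For `c = some a` these form a centrally symmetric pair, and both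
are flipped; for `c = none`, which plays the role of the extra color, the diagonal that is flipped is
the central one. (A central diagonal equals its own opposite.) -/
def Flip (c : Option (Fin n)) (t t' : K.ColoredTriangulation) : Prop :=
  ∃ d d', K.FlipsTo t.diagonals d d' ∧ t.color d = c ∧
    (∀ e, e ∈ t'.diagonals ↔
      ((e ∈ t.diagonals ∧ e ≠ d ∧ e ≠ opposite d) ∨ e = d' ∨ e = opposite d')) ∧
    t'.color d' = c ∧
    ∀ e ∈ t.diagonals, e ≠ d → e ≠ opposite d → t'.color e = t.color e

variable (K)

/-- The colorful exchange graph. -/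
def exchangeGraph : SimpleGraph K.ColoredTriangulation :=
  SimpleGraph.fromRel fun t t' => ∃ c, Flip c t t'

variable {K}

/-- The vertex set of the face `(C, t)`: all colored triangulations that are obtained from `t` by
a sequence of flips with colors in `C`. -/
def faceSet (C : Finset (Option (Fin n))) (t : K.ColoredTriangulation) :
    Set K.ColoredTriangulation :=
  {s | Relation.ReflTransGen (fun a b => ∃ c ∈ C, Flip c a b) t s}

variable (K)

/-- The colorful cyclohedron: its faces are the empty set and the sets `faceSet C t`, and they are
ordered by inclusion. -/
abbrev ColorfulCyclohedron : Type :=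
  {F : Set K.ColoredTriangulation // F = ∅ ∨ ∃ C t, F = faceSet C t}

variable {K}

/-- The face `(C, t)` of the colorful cyclohedron. -/
def face (C : Finset (Option (Fin n))) (t : K.ColoredTriangulation) : K.ColorfulCyclohedron :=
  ⟨faceSet C t, Or.inr ⟨C, t, rfl⟩⟩

end SymmetricPolygon

section StrongConnectedness

open Relation

variable {P : Type*} [PartialOrder P]

/-- Any two elements of `S` are joined by a path in the comparability graph of `S`. -/
def ComparabilityConnected (S : Set P) : Prop := ∀ F G : S, EqvGen (· ≤ ·) F G

/-- Strong connectedness of a poset in the sense of McMullen and Schulte: every open interval that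
contains two comparable elements, i.e. every section of rank at least two, is connected. -/
def IsStronglyConnected (P : Type*) [PartialOrder P] : Prop :=
  ∀ A B : P, (∃ F G, A < F ∧ F < G ∧ G < B) → ComparabilityConnected (Set.Ioo A B)

/-- The elements that can be added to the chain `X`. -/
def chainLink (X : Set P) : Set P := {F | F ∉ X ∧ ∀ E ∈ X, F ≤ E ∨ E ≤ F}

/-- The flags `Φ` and `Ψ` are joined by a sequence of successively adjacent flags, all of which
contain `X`. -/
def FlagsLinked (X : Set P) (Φ Ψ : Flag P) : Prop :=
  ReflTransGen (fun A B : Flag P => FlagAdjacent A B ∧ X ⊆ A ∧ X ⊆ B) Φ Ψ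

lemma FlagsLinked.symm {X : Set P} {Φ Ψ : Flag P} (h : FlagsLinked X Φ Ψ) :
    FlagsLinked X Ψ Φ :=
  have : Std.Symm fun A B : Flag P => FlagAdjacent A B ∧ X ⊆ A ∧ X ⊆ B :=
    ⟨fun _ _ hAB => ⟨hAB.1.symm, hAB.2.2, hAB.2.1⟩⟩
  ReflTransGen.stdSymm.symm _ _ h

lemma FlagsLinked.mono {X Y : Set P} (hXY : X ⊆ Y) {Φ Ψ : Flag P} (h : FlagsLinked Y Φ Ψ) :
    FlagsLinked X Φ Ψ :=
  ReflTransGen.mono (fun _ _ hAB => ⟨hAB.1, hXY.trans hAB.2.1, hXY.trans hAB.2.2⟩) _ _ h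

lemma mem_chainLink_inter {Φ Ψ : Flag P} {F : P} (hΦ : F ∈ Φ) (hΨ : F ∉ Ψ) :
    F ∈ chainLink (Φ ∩ Ψ : Set P) :=
  ⟨fun hF => hΨ hF.2, fun _ hE => Φ.le_or_le hΦ hE.1⟩

lemma exists_gap_of_mem_chainLink [BoundedOrder P] {X : Set P} (hX : X.Finite)
    (hchain : IsChain (· ≤ ·) X) (hbot : ⊥ ∈ X) (htop : ⊤ ∈ X) {F : P} (hF : F ∈ chainLink X) :
    ∃ A ∈ X, ∃ B ∈ X, A < F ∧ F < B ∧ ∀ E ∈ X, E ≤ A ∨ B ≤ E := by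
  have lt_or_gt : ∀ E ∈ X, E < F ∨ F < E := fun E hE =>
    have hne : F ≠ E := fun h => hF.1 (h ▸ hE)
    (hF.2 E hE).symm.imp (·.lt_of_ne' hne) (·.lt_of_ne hne)
  obtain ⟨A, hA⟩ := (hX.inter_of_left {E | E < F}).exists_maximal
    ⟨⊥, hbot, (lt_or_gt ⊥ hbot).resolve_right not_lt_bot⟩
  obtain ⟨B, hB⟩ := (hX.inter_of_left {E | F < E}).exists_minimal
    ⟨⊤, htop, (lt_or_gt ⊤ htop).resolve_left not_top_lt⟩
  refine ⟨A, hA.prop.1, B, hB.prop.1, hA.prop.2, hB.prop.2, fun E hE => ?_⟩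
  refine (lt_or_gt E hE).imp (fun hEF => ?_) fun hFE => ?_
  · exact (hchain.total hE hA.prop.1).elim id fun h => hA.le_of_ge ⟨hE, hEF⟩ h
  · exact (hchain.total hE hB.prop.1).elim (fun h => hB.le_of_le ⟨hE, hFE⟩ h) id

/-- Either all elements that can be added to `X` are in one gap of `X`, which is connected by
assumption, or elements in different gaps are comparable. -/
lemma IsStronglyConnected.comparabilityConnected_chainLink [BoundedOrder P]
    (h : IsStronglyConnected P) {X : Set P} (hX : X.Finite) (hchain : IsChain (· ≤ ·) X)
    (hbot : ⊥ ∈ X) (htop : ⊤ ∈ X) {F H : P} (hF : F ∈ chainLink X) (hH : H ∈ chainLink X)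
    (hFH : F < H) : ComparabilityConnected (chainLink X) := by
  obtain ⟨A, hAX, B, hBX, hAF, hFB, hgap⟩ := exists_gap_of_mem_chainLink hX hchain hbot htop hF
  have outside {E : P} (hE : E ∈ chainLink X) (hE' : E ∉ Set.Ioo A B) : E ≤ A ∨ B ≤ E := by
    have hEA : A ≠ E := fun he => hE.1 (he ▸ hAX)
    have hEB : E ≠ B := fun he => hE.1 (he ▸ hBX)
    by_contra! hcon
    exact hE' ⟨((hE.2 A hAX).resolve_left hcon.1).lt_of_ne hEA,
      ((hE.2 B hBX).resolve_right hcon.2).lt_of_ne hEB⟩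
  have inside : Set.Ioo A B ⊆ chainLink X := fun E hE =>
    ⟨fun hEX => (hgap E hEX).elim hE.1.not_ge hE.2.not_ge,
      fun G hG => (hgap G hG).symm.imp hE.2.le.trans (·.trans hE.1.le)⟩
  by_cases hsub : chainLink X ⊆ Set.Ioo A B
  · rw [hsub.antisymm inside]
    exact h A B ⟨F, H, hAF, hFH, (hsub hH).2⟩
  obtain ⟨E, hE, hEgap⟩ := Set.not_subset.1 hsub
  have joined {G G' : chainLink X} (hG : G.1 ∉ Set.Ioo A B) (hG' : G'.1 ∈ Set.Ioo A B) :
      EqvGen (· ≤ ·) G G' := by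
    rcases outside G.2 hG with hGA | hBG
    · exact .rel _ _ (hGA.trans hG'.1.le)
    · exact .symm _ _ (.rel _ _ (hG'.2.le.trans hBG))
  have joined_F (G : chainLink X) : EqvGen (· ≤ ·) G ⟨F, hF⟩ := by
    by_cases hG : G.1 ∈ Set.Ioo A B
    · exact .trans _ _ _ (.symm _ _ (joined (G := ⟨E, hE⟩) hEgap hG)) (joined hEgap ⟨hAF, hFB⟩)
    · exact joined hG ⟨hAF, hFB⟩
  exact fun G G' => .trans _ _ _ (joined_F G) (.symm _ _ (joined_F G'))

lemma exists_flag_insert_subset {Φ : Flag P} {X : Set P} (hX : X ⊆ Φ) {F G : P}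
    (hF : F ∈ chainLink X) (hG : G ∈ chainLink X) (hFG : F ≤ G) :
    ∃ Ψ : Flag P, insert F X ⊆ Ψ ∧ insert G X ⊆ Ψ := by
  have hchain : IsChain (· ≤ ·) (insert F (insert G X)) := by
    refine ((Φ.chain_le.mono hX).insert fun E hE _ => hG.2 E hE).insert fun E hE _ => ?_
    rcases hE with rfl | hE
    exacts [Or.inl hFG, hF.2 E hE]
  obtain ⟨Ψ, hΨ⟩ := hchain.exists_subset_flag
  exact ⟨Ψ, (Set.insert_subset_insert (Set.subset_insert G X)).trans hΨ,
    (Set.subset_insert F _).trans hΨ⟩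

lemma flagsLinked_of_comparabilityConnected {X : Set P}
    (hconn : ComparabilityConnected (chainLink X))
    (hlink : ∀ F ∈ chainLink X, ∀ Φ Ψ : Flag P, insert F X ⊆ Φ → insert F X ⊆ Ψ →
      FlagsLinked X Φ Ψ)
    {Φ Ψ : Flag P} (hΦ : X ⊆ Φ) (hΨ : X ⊆ Ψ) {F G : P} (hF : F ∈ chainLink X) (hFΦ : F ∈ Φ)
    (hG : G ∈ chainLink X) (hGΨ : G ∈ Ψ) : FlagsLinked X Φ Ψ := by
  suffices ∀ F G : chainLink X, EqvGen (· ≤ ·) F G → ∀ Φ' Ψ' : Flag P, insert F.1 X ⊆ Φ' →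
      insert G.1 X ⊆ Ψ' → FlagsLinked X Φ' Ψ' from
    this ⟨F, hF⟩ ⟨G, hG⟩ (hconn _ _) Φ Ψ (Set.insert_subset hFΦ hΦ) (Set.insert_subset hGΨ hΨ)
  clear hF hFΦ hG hGΨ
  intro F G hFG
  induction hFG with
  | rel F G hFG =>
    intro Φ' Ψ' hΦ' hΨ'
    obtain ⟨Ω, hFΩ, hGΩ⟩ := exists_flag_insert_subset hΦ F.2 G.2 hFG
    exact (hlink F F.2 Φ' Ω hΦ' hFΩ).trans (hlink G G.2 Ω Ψ' hGΩ hΨ')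
  | refl F => exact hlink F F.2
  | symm F G _ ih => exact fun Φ' Ψ' hΦ' hΨ' => (ih Ψ' Φ' hΨ' hΦ').symm
  | trans F E G _ _ ihF ihG =>
    intro Φ' Ψ' hΦ' hΨ'
    obtain ⟨Ω, hΩ, -⟩ := exists_flag_insert_subset hΦ E.2 E.2 le_rfl
    exact (ihF Φ' Ω hΦ' hΩ).trans (ihG Ω Ψ' hΩ hΨ')

section Graded

variable [BoundedOrder P] [GradeOrder ℤ P]

lemma bijOn_grade_flag (Φ : Flag P) :
    Set.BijOn (grade ℤ) (Φ : Set P) (Set.Icc (grade ℤ (⊥ : P)) (grade ℤ (⊤ : P))) := by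
  have hmaps : Set.MapsTo (grade ℤ) (Φ : Set P) (Set.Icc (grade ℤ (⊥ : P)) (grade ℤ (⊤ : P))) :=
    fun F _ => ⟨grade_mono bot_le, grade_mono le_top⟩
  have hinj : Set.InjOn (grade ℤ) (Φ : Set P) := by
    intro F hF G hG hFG
    by_contra hne
    rcases Φ.le_or_le hF hG with h | h
    · exact (grade_strictMono (h.lt_of_ne hne)).ne hFG
    · exact (grade_strictMono (h.lt_of_ne' hne)).ne' hFG
  refine ⟨hmaps, hinj, fun k hk => ?_⟩
  have : Finite Φ := Set.Finite.of_injOn hmaps hinj (Set.finite_Icc _ _)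
  obtain ⟨hk, hk'⟩ := hk
  induction k, hk using Int.leInduction with
  | base => exact ⟨⊥, Φ.bot_mem, rfl⟩
  | succ k _ ih =>
    obtain ⟨F, hF, rfl⟩ := ih (by lia)
    have hlt : (⟨F, hF⟩ : Φ) < ⊤ := lt_top_iff_ne_top.2 fun h => by
      have hFtop : F = ⊤ := congrArg Subtype.val h
      subst hFtop
      lia
    obtain ⟨G, hFG, -⟩ := exists_covBy_le_of_lt hlt
    exact ⟨G, G.2, (Order.covBy_iff_add_one_eq.1 ((Flag.coe_covBy_coe.2 hFG).grade ℤ)).symm⟩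

lemma finite_flag (Φ : Flag P) : (Φ : Set P).Finite :=
  .of_injOn (bijOn_grade_flag Φ).mapsTo (bijOn_grade_flag Φ).injOn (Set.finite_Icc _ _)

lemma ncard_flag (Φ : Flag P) :
    (Φ : Set P).ncard = (grade ℤ (⊤ : P) + 1 - grade ℤ (⊥ : P)).toNat := by
  rw [(bijOn_grade_flag Φ).ncard_eq, ← Finset.coe_Icc, Set.ncard_coe_finset, Int.card_Icc]

lemma ncard_flag_inter_add_ncard_diff (Φ Ψ : Flag P) :
    (Φ ∩ Ψ : Set P).ncard + (Φ \ Ψ : Set P).ncard =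
      (grade ℤ (⊤ : P) + 1 - grade ℤ (⊥ : P)).toNat := by
  rw [Set.ncard_inter_add_ncard_sdiff_eq_ncard _ _ (finite_flag Φ), ncard_flag]

lemma ncard_flag_diff_comm (Φ Ψ : Flag P) :
    (Φ \ Ψ : Set P).ncard = (Ψ \ Φ : Set P).ncard := by
  have hΦ := ncard_flag_inter_add_ncard_diff Φ Ψ
  have hΨ := ncard_flag_inter_add_ncard_diff Ψ Φ
  rw [Set.inter_comm] at hΨ
  lia

/-- By induction on the number of faces in which the two flags differ: if there are at least two,
a path in the link of `Φ ∩ Ψ` gives intermediate flags, and consecutive ones of them have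
a face outside of `Φ ∩ Ψ` in common. -/
theorem IsStronglyConnected.flagsLinked (h : IsStronglyConnected P) (Φ Ψ : Flag P) :
    FlagsLinked (Φ ∩ Ψ : Set P) Φ Ψ := by
  induction hk : (Φ \ Ψ : Set P).ncard using Nat.strong_induction_on generalizing Φ Ψ with
  | _ k ih =>
  subst hk
  rcases lt_trichotomy (Φ \ Ψ : Set P).ncard 1 with hlt | heq | hgt
  · have hdiff : (Φ \ Ψ : Set P) = ∅ :=
      (Set.ncard_eq_zero (finite_flag Φ).sdiff).1 (Nat.lt_one_iff.1 hlt)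
    obtain rfl : Φ = Ψ := Flag.ext (Φ.max_chain' Ψ.chain_le (Set.sdiff_eq_empty.1 hdiff))
    exact ReflTransGen.refl
  · exact ReflTransGen.single ⟨⟨heq, ncard_flag_diff_comm Φ Ψ ▸ heq⟩,
      Set.inter_subset_left, Set.inter_subset_right⟩
  · obtain ⟨G, hG⟩ : (Ψ \ Φ : Set P).Nonempty :=
      Set.nonempty_of_ncard_ne_zero (ncard_flag_diff_comm Φ Ψ ▸ by lia)
    obtain ⟨F, hF, H, hH, hFH⟩ : ∃ F ∈ (Φ \ Ψ : Set P), ∃ H ∈ (Φ \ Ψ : Set P), F < H := by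
      obtain ⟨F, H, hF, hH, hne⟩ := (Set.one_lt_ncard_iff (finite_flag Φ).sdiff).1 hgt
      rcases Φ.le_or_le hF.1 hH.1 with hle | hle
      exacts [⟨F, hF, H, hH, hle.lt_of_ne hne⟩, ⟨H, hH, F, hF, hle.lt_of_ne' hne⟩]
    have hlinkF := mem_chainLink_inter hF.1 hF.2
    have hconn : ComparabilityConnected (chainLink (Φ ∩ Ψ : Set P)) :=
      h.comparabilityConnected_chainLink ((finite_flag Φ).inter_of_left _)
        (Φ.chain_le.mono Set.inter_subset_left) ⟨Φ.bot_mem, Ψ.bot_mem⟩ ⟨Φ.top_mem, Ψ.top_mem⟩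
        hlinkF (mem_chainLink_inter hH.1 hH.2) hFH
    refine flagsLinked_of_comparabilityConnected hconn (fun E hE Φ' Ψ' hΦ' hΨ' => ?_)
      Set.inter_subset_left Set.inter_subset_right hlinkF hF.1
      (Set.inter_comm (Ψ : Set P) Φ ▸ mem_chainLink_inter hG.1 hG.2) hG.1
    have hsub : insert E (Φ ∩ Ψ : Set P) ⊆ Φ' ∩ Ψ' := Set.subset_inter hΦ' hΨ'
    have hcard := Set.ncard_le_ncard hsub ((finite_flag Φ').inter_of_left _)
    rw [Set.ncard_insert_of_notMem hE.1 ((finite_flag Φ).inter_of_left _)] at hcard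
    have hsum := ncard_flag_inter_add_ncard_diff Φ Ψ
    have hsum' := ncard_flag_inter_add_ncard_diff Φ' Ψ'
    exact (ih _ (by lia) Φ' Ψ' rfl).mono ((Set.subset_insert _ _).trans hsub)

end Graded

end StrongConnectedness

section ColorfulGraph

open Relation

variable {V κ : Type*}

/-- The vertices that are reached from `v` along edges with colors in `C`. -/
def colorComponent (R : κ → V → V → Prop) (C : Finset κ) (v : V) : Set V :=
  {w | ReflTransGen (fun a b => ∃ c ∈ C, R c a b) v w}

/-- The faces of the polytope of an edge-colored graph, ordered by inclusion: the empty set and the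
connected components of the subgraphs that are given by sets of colors. -/
abbrev ColorFace (R : κ → V → V → Prop) : Type _ :=
  {F : Set V // F = ∅ ∨ ∃ C v, F = colorComponent R C v}

/-- `R c v w` says that `v` and `w` are joined by an edge of color `c`, for a connected graph with
the following properties: every vertex is on exactly one edge of each color, and the ends of
an edge are not joined by a path that avoids the color of the edge. The last property makes the
polytope of the graph simple. -/
class IsColorfulGraph (R : κ → V → V → Prop) : Prop where
  exists_rel : ∀ c v, ∃ w, R c v w
  unique : ∀ {c v w w'}, R c v w → R c v w' → w = w'
  symm : ∀ {c v w}, R c v w → R c w v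
  notMem : ∀ {c v w D}, R c v w → c ∉ D → w ∉ colorComponent R D v
  connected : ∀ v w, ReflTransGen (fun a b => ∃ c, R c a b) v w

section Component

variable {R : κ → V → V → Prop} {C D : Finset κ} {c : κ} {v w : V}

lemma self_mem_colorComponent : v ∈ colorComponent R C v := ReflTransGen.refl

lemma colorComponent_mono (h : C ⊆ D) : colorComponent R C v ⊆ colorComponent R D v :=
  fun w => ReflTransGen.mono (fun _ _ ⟨c, hc, hab⟩ => ⟨c, h hc, hab⟩) v w

lemma mem_colorComponent_of_rel (hc : c ∈ C) (h : R c v w) : w ∈ colorComponent R C v :=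
  ReflTransGen.single ⟨c, hc, h⟩

lemma colorComponent_empty : colorComponent R ∅ v = {v} := by
  refine Set.eq_singleton_iff_unique_mem.2 ⟨self_mem_colorComponent, fun w hw => ?_⟩
  rcases hw.cases_head with rfl | ⟨_, ⟨_, hc, _⟩, _⟩
  exacts [rfl, absurd hc (Finset.notMem_empty _)]

variable [IsColorfulGraph R]

lemma colorComponent_eq (hw : w ∈ colorComponent R C v) :
    colorComponent R C w = colorComponent R C v := by
  have : Std.Symm fun a b => ∃ c ∈ C, R c a b :=
    ⟨fun _ _ ⟨c, hc, hab⟩ => ⟨c, hc, IsColorfulGraph.symm hab⟩⟩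
  have hv : v ∈ colorComponent R C w := ReflTransGen.stdSymm.symm _ _ hw
  exact Set.Subset.antisymm (fun _ hx => ReflTransGen.trans hw hx)
    fun _ hx => ReflTransGen.trans hv hx

lemma colorComponent_singleton (h : R c v w) : colorComponent R {c} v = {v, w} := by
  ext u
  refine ⟨fun hu => ?_, ?_⟩
  · induction hu with
    | refl => exact Or.inl rfl
    | tail _ hab ih =>
      obtain ⟨c', hc', hab⟩ := hab
      obtain rfl := Finset.mem_singleton.1 hc'
      rcases ih with rfl | rfl
      · exact Or.inr (IsColorfulGraph.unique hab h)
      · exact Or.inl (IsColorfulGraph.unique hab (IsColorfulGraph.symm h))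
  · rintro (rfl | rfl)
    exacts [self_mem_colorComponent, mem_colorComponent_of_rel (Finset.mem_singleton_self c) h]

end Component

namespace ColorFace

variable {R : κ → V → V → Prop}

/-- The component of `v` in the subgraph of the edges with colors in `C`, as a face. -/
def of (R : κ → V → V → Prop) (C : Finset κ) (v : V) : ColorFace R :=
  ⟨colorComponent R C v, Or.inr ⟨C, v, rfl⟩⟩

instance : OrderBot (ColorFace R) where
  bot := ⟨∅, Or.inl rfl⟩
  bot_le _ := Set.empty_subset _

lemma eq_bot_or_eq_of (F : ColorFace R) : F = ⊥ ∨ ∃ C v, F = of R C v :=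
  F.2.imp Subtype.ext fun ⟨C, v, hF⟩ => ⟨C, v, Subtype.ext hF⟩

lemma bot_lt_of (C : Finset κ) (v : V) : ⊥ < of R C v :=
  lt_of_le_not_ge bot_le fun h => Set.notMem_empty v (h self_mem_colorComponent)

lemma coe_of (C : Finset κ) (v : V) : (of R C v).1 = colorComponent R C v := rfl

lemma of_empty_le_iff {F : ColorFace R} {v : V} : of R ∅ v ≤ F ↔ v ∈ F.1 := by
  refine ⟨fun h => h self_mem_colorComponent, fun hv => ?_⟩
  change colorComponent R ∅ v ⊆ F.1
  rwa [colorComponent_empty, Set.singleton_subset_iff]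

variable (R) in
lemma of_empty_injective : Function.Injective (of R ∅) := fun v w h =>
  Set.singleton_injective (by simpa only [of, Subtype.mk.injEq, colorComponent_empty] using h)

/-- The colors of the edges in a face. -/
def colors (F : ColorFace R) : Set κ := {c | ∃ v ∈ F.1, ∃ w ∈ F.1, R c v w}

lemma colors_mono {F G : ColorFace R} (h : F ≤ G) : F.colors ⊆ G.colors :=
  fun _ ⟨v, hv, w, hw, hvw⟩ => ⟨v, h hv, w, h hw, hvw⟩

open Classical in
/-- The rank of a face: the number of its colors, and `-1` for the empty face. -/
noncomputable def rank (F : ColorFace R) : ℤ := if F = ⊥ then -1 else F.colors.ncard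

@[simp] lemma rank_bot : rank (⊥ : ColorFace R) = -1 := if_pos rfl

section Colorful

variable [IsColorfulGraph R] {C D : Finset κ} {v w : V}

lemma of_congr (hw : w ∈ colorComponent R C v) : of R C w = of R C v :=
  Subtype.ext (colorComponent_eq hw)

lemma colors_of : (of R C v).colors = C := by
  refine Set.Subset.antisymm ?_ fun c hc => ?_
  · rintro c ⟨a, ha, b, hb, hab⟩
    by_contra hc
    refine IsColorfulGraph.notMem hab hc ?_
    rw [colorComponent_eq ha]
    exact hb
  · obtain ⟨w, hw⟩ := IsColorfulGraph.exists_rel (R := R) c v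
    exact ⟨v, self_mem_colorComponent, w, mem_colorComponent_of_rel hc hw, hw⟩

@[simp] lemma rank_of : rank (of R C v) = C.card := by
  rw [rank, if_neg (bot_lt_of C v).ne', colors_of, Set.ncard_coe_finset]

lemma of_le_iff : of R C v ≤ of R D w ↔ C ⊆ D ∧ v ∈ colorComponent R D w := by
  refine ⟨fun h => ⟨?_, h self_mem_colorComponent⟩, fun ⟨hCD, hv⟩ => ?_⟩
  · simpa only [colors_of, Finset.coe_subset] using colors_mono h
  · rw [← of_congr hv]
    exact colorComponent_mono hCD

lemma exists_of_eq {G : ColorFace R} (h : of R C v ≤ G) : ∃ D, G = of R D v := by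
  rcases G.eq_bot_or_eq_of with rfl | ⟨D, w, rfl⟩
  · exact absurd h (bot_lt_of C v).not_ge
  · exact ⟨D, (of_congr (of_le_iff.1 h).2).symm⟩

variable (R) in
/-- The faces that contain a given vertex, as a copy of the finite sets of colors. -/
def ofEmbedding (v : V) : Finset κ ↪o ColorFace R :=
  OrderEmbedding.ofMapLEIff (fun C => of R C v) fun _ _ =>
    of_le_iff.trans (and_iff_left self_mem_colorComponent)

lemma image_Ioo_ofEmbedding (C D : Finset κ) (v : V) :
    ofEmbedding R v '' Set.Ioo C D = Set.Ioo (of R C v) (of R D v) := by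
  refine Set.Subset.antisymm (ofEmbedding R v).strictMono.image_Ioo_subset fun G hG => ?_
  obtain ⟨E, rfl⟩ := exists_of_eq hG.1.le
  exact ⟨E, ⟨(ofEmbedding R v).lt_iff_lt.1 hG.1, (ofEmbedding R v).lt_iff_lt.1 hG.2⟩, rfl⟩

lemma rank_strictMono : StrictMono (rank (R := R)) := by
  intro F G hFG
  rcases F.eq_bot_or_eq_of with rfl | ⟨C, v, rfl⟩
  · obtain ⟨D, w, rfl⟩ := G.eq_bot_or_eq_of.resolve_left hFG.ne'
    rw [rank_bot, rank_of]
    lia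
  · obtain ⟨D, rfl⟩ := exists_of_eq hFG.le
    rw [rank_of, rank_of, Nat.cast_lt]
    exact Finset.card_strictMono ((ofEmbedding R v).lt_iff_lt.1 hFG)

lemma rank_covBy_of_covBy ⦃F G : ColorFace R⦄ (h : F ⋖ G) : rank F ⋖ rank G := by
  rw [Order.covBy_iff_add_one_eq]
  rcases F.eq_bot_or_eq_of with rfl | ⟨C, v, rfl⟩
  · obtain ⟨D, w, rfl⟩ := G.eq_bot_or_eq_of.resolve_left h.ne'
    have hle : of R ∅ w ≤ of R D w := (ofEmbedding R w).monotone D.empty_subset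
    rw [← (h.wcovBy.eq_or_eq bot_le hle).resolve_left (bot_lt_of ∅ w).ne', rank_bot, rank_of]
    rfl
  · obtain ⟨D, rfl⟩ := exists_of_eq h.le
    have hcov : C ⋖ D := CovBy.of_image (ofEmbedding R v) h
    have hcard := Order.covBy_iff_add_one_eq.1 hcov.card_finset
    rw [rank_of, rank_of]
    exact_mod_cast hcard

noncomputable instance : GradeOrder ℤ (ColorFace R) where
  grade := rank
  grade_strictMono := rank_strictMono
  covBy_grade := rank_covBy_of_covBy

noncomputable instance [Fintype κ] [Nonempty V] : BoundedOrder (ColorFace R) where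
  top := of R Finset.univ (Classical.arbitrary V)
  le_top _ := fun v _ => ReflTransGen.mono (fun _ _ ⟨c, h⟩ => ⟨c, Finset.mem_univ c, h⟩) _ _
    (IsColorfulGraph.connected (R := R) (Classical.arbitrary V) v)

lemma rank_top [Fintype κ] [Nonempty V] : rank (⊤ : ColorFace R) = Fintype.card κ := rank_of

lemma exists_eq_of_empty_of_rank_eq_zero {F : ColorFace R} (hF : rank F = 0) :
    ∃ v, F = of R ∅ v := by
  rcases F.eq_bot_or_eq_of with rfl | ⟨C, v, rfl⟩
  · rw [rank_bot] at hF
    lia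
  · rw [rank_of, Nat.cast_eq_zero, Finset.card_eq_zero] at hF
    exact ⟨v, by rw [hF]⟩

lemma exists_eq_of_singleton_of_rank_eq_one {F : ColorFace R} (hF : rank F = 1) :
    ∃ c v, F = of R {c} v := by
  rcases F.eq_bot_or_eq_of with rfl | ⟨C, v, rfl⟩
  · rw [rank_bot] at hF
    lia
  · rw [rank_of, Nat.cast_eq_one, Finset.card_eq_one] at hF
    obtain ⟨c, rfl⟩ := hF
    exact ⟨c, v, rfl⟩

lemma Ioo_bot_of_singleton {c : κ} (h : R c v w) :
    Set.Ioo ⊥ (of R {c} v) = {of R ∅ v, of R ∅ w} := by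
  have mem_of {u : V} (hu : u = v ∨ u = w) : of R ∅ u ∈ Set.Ioo ⊥ (of R {c} v) := by
    refine ⟨bot_lt_of _ _, lt_of_le_of_ne ?_ fun he => ?_⟩
    · rw [of_empty_le_iff, coe_of, colorComponent_singleton h]
      exact hu
    · simpa only [rank_of, Finset.card_empty, Finset.card_singleton, Nat.cast_inj, zero_ne_one]
        using congrArg rank he
  refine Set.Subset.antisymm (fun F hF => ?_) ?_
  · have hbot := rank_strictMono hF.1
    have hlt := rank_strictMono hF.2
    rw [rank_bot] at hbot
    rw [rank_of, Finset.card_singleton] at hlt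
    obtain ⟨u, rfl⟩ := exists_eq_of_empty_of_rank_eq_zero (F := F) (by lia)
    have hu := of_empty_le_iff.1 hF.2.le
    rw [coe_of, colorComponent_singleton h] at hu
    exact hu.imp (congrArg _) (congrArg _)
  · rintro _ (rfl | rfl)
    exacts [mem_of (.inl rfl), mem_of (.inr rfl)]

lemma ncard_Ioo_eq_two {F G : ColorFace R} (hFG : F < G) (hrank : rank G = rank F + 2) :
    (Set.Ioo F G).ncard = 2 := by
  rcases F.eq_bot_or_eq_of with rfl | ⟨C, v, rfl⟩
  · obtain ⟨c, v, rfl⟩ :=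
      exists_eq_of_singleton_of_rank_eq_one (F := G) (by rw [hrank, rank_bot]; rfl)
    obtain ⟨w, hw⟩ := IsColorfulGraph.exists_rel (R := R) c v
    have hne : v ≠ w := by
      rintro rfl
      exact IsColorfulGraph.notMem hw (Finset.notMem_empty c) self_mem_colorComponent
    rw [Ioo_bot_of_singleton hw, Set.ncard_pair ((of_empty_injective R).ne hne)]
  · classical
    obtain ⟨D, rfl⟩ := exists_of_eq hFG.le
    have hCD : C ⊆ D := (ofEmbedding R v).le_iff_le.1 hFG.le
    rw [rank_of, rank_of] at hrank
    rw [← image_Ioo_ofEmbedding, Set.ncard_image_of_injective _ (ofEmbedding R v).injective,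
      ← Finset.coe_Ioo, Set.ncard_coe_finset, Finset.card_Ioo_finset hCD,
      show D.card - C.card = 2 by lia]
    rfl

lemma diamond (j : ℤ) (F G : ColorFace R) (hF : rank F = j - 1) (hG : rank G = j + 1)
    (hFG : F < G) : {H : ColorFace R | rank H = j ∧ F < H ∧ H < G}.ncard = 2 := by
  rw [← ncard_Ioo_eq_two hFG (by lia)]
  congr 1
  ext H
  refine ⟨fun hH => hH.2, fun hH => ⟨?_, hH⟩⟩
  have hFH := rank_strictMono hH.1
  have hHG := rank_strictMono hH.2
  lia

end Colorful

end ColorFace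

section Connectedness

lemma ComparabilityConnected.image {P Q : Type*} [PartialOrder P] [PartialOrder Q] {f : P → Q}
    (hf : Monotone f) {S : Set P} (hS : ComparabilityConnected S) :
    ComparabilityConnected (f '' S) := by
  suffices ∀ F G : S, EqvGen (· ≤ ·) F G →
      EqvGen (· ≤ ·) (⟨f F, F, F.2, rfl⟩ : f '' S) ⟨f G, G, G.2, rfl⟩ by
    rintro ⟨_, F, hF, rfl⟩ ⟨_, G, hG, rfl⟩
    exact this ⟨F, hF⟩ ⟨G, hG⟩ (hS _ _)
  intro F G h
  induction h with
  | rel F G hFG => exact .rel _ _ (hf hFG)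
  | refl F => exact .refl _
  | symm _ _ _ ih => exact .symm _ _ ih
  | trans _ _ _ _ _ ih ih' => exact .trans _ _ _ ih ih'

lemma isStronglyConnected_finset (α : Type*) : IsStronglyConnected (Finset α) := by
  classical
  rintro C D ⟨F, G, hCF, hFG, hGD⟩
  have hcard : C.card + 3 ≤ D.card := by
    have hCF := Finset.card_lt_card hCF
    have hFG := Finset.card_lt_card hFG
    have hGD := Finset.card_lt_card hGD
    lia
  have mem_Ioo {x y : α} (hxD : x ∈ D) (hxC : x ∉ C) (hy : y ∈ D) :
      insert x (insert y C) ∈ Set.Ioo C D := by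
    refine ⟨(Finset.ssubset_insert hxC).trans_subset
      (Finset.insert_subset_insert x (Finset.subset_insert y C)), ?_⟩
    refine (Finset.insert_subset hxD (Finset.insert_subset hy (hCF.trans
      (hFG.trans hGD)).subset)).ssubset_of_ne fun h => ?_
    have h₁ := Finset.card_insert_le x (insert y C)
    have h₂ := Finset.card_insert_le y C
    rw [h] at h₁
    lia
  rintro ⟨E, hE⟩ ⟨E', hE'⟩
  obtain ⟨x, hxE, hxC⟩ := Finset.exists_of_ssubset hE.1
  obtain ⟨y, hyE', hyC⟩ := Finset.exists_of_ssubset hE'.1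
  have hxD := hE.2.subset hxE
  have hyD := hE'.2.subset hyE'
  have joined {z : α} {B B' : Set.Ioo C D} (hzD : z ∈ D) (hzC : z ∉ C) (hzB : z ∈ B.1)
      (hzB' : z ∈ B'.1) : EqvGen (· ≤ ·) B B' := by
    let Z : Set.Ioo C D := ⟨insert z (insert z C), mem_Ioo hzD hzC hzD⟩
    have Z_le {A : Set.Ioo C D} (hzA : z ∈ A.1) : Z ≤ A :=
      Finset.insert_subset hzA (Finset.insert_subset hzA A.2.1.subset)
    exact .trans _ _ _ (.symm _ _ (.rel _ _ (Z_le hzB))) (.rel _ _ (Z_le hzB'))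
  exact .trans _ ⟨_, mem_Ioo hxD hxC hyD⟩ _ (joined hxD hxC hxE (Finset.mem_insert_self _ _))
    (joined hyD hyC (Finset.mem_insert_of_mem (Finset.mem_insert_self _ _)) hyE')

namespace ColorFace

variable {R : κ → V → V → Prop} [IsColorfulGraph R]

lemma comparabilityConnected_Ioo_bot {D : Finset κ} (hD : 2 ≤ D.card) (v : V) :
    ComparabilityConnected (Set.Ioo ⊥ (of R D v)) := by
  have mem_Ioo {C : Finset κ} (hC : C ⊆ D) (hcard : C.card ≤ 1) {u : V}
      (hu : u ∈ colorComponent R D v) : of R C u ∈ Set.Ioo ⊥ (of R D v) := by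
    refine ⟨bot_lt_of C u, (of_le_iff.2 ⟨hC, hu⟩).lt_of_ne fun h => ?_⟩
    have := congrArg rank h
    rw [rank_of, rank_of] at this
    lia
  have mem_vertex {u : V} (hu : u ∈ colorComponent R D v) :
      of R ∅ u ∈ Set.Ioo ⊥ (of R D v) := mem_Ioo D.empty_subset zero_le_one hu
  have joined_vertex {u : V} (hu : u ∈ colorComponent R D v) :
      EqvGen (· ≤ ·) (⟨of R ∅ v, mem_vertex self_mem_colorComponent⟩ : Set.Ioo ⊥ (of R D v))
        ⟨of R ∅ u, mem_vertex hu⟩ := by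
    induction hu with
    | refl => exact .refl _
    | @tail a b ha hab ih =>
      obtain ⟨c, hcD, hc⟩ := hab
      have hb : b ∈ colorComponent R {c} a :=
        mem_colorComponent_of_rel (Finset.mem_singleton_self c) hc
      let edge : Set.Ioo ⊥ (of R D v) :=
        ⟨of R {c} a, mem_Ioo (Finset.singleton_subset_iff.2 hcD) (Finset.card_singleton c).le ha⟩
      exact .trans _ _ _ ih (.trans _ edge _
        (.rel _ _ (of_empty_le_iff.2 self_mem_colorComponent))
        (.symm _ _ (.rel _ _ (of_empty_le_iff.2 hb))))
  have joined (F : Set.Ioo ⊥ (of R D v)) :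
      EqvGen (· ≤ ·) ⟨of R ∅ v, mem_vertex self_mem_colorComponent⟩ F := by
    obtain ⟨F, hF⟩ := F
    obtain ⟨C, u, rfl⟩ := F.eq_bot_or_eq_of.resolve_left hF.1.ne'
    exact .trans _ _ _ (joined_vertex (of_le_iff.1 hF.2.le).2)
      (.rel _ _ (of_empty_le_iff.2 self_mem_colorComponent))
  exact fun F G => .trans _ _ _ (.symm _ _ (joined F)) (joined G)

variable (R) in
lemma isStronglyConnected : IsStronglyConnected (ColorFace R) := by
  rintro A B ⟨F, G, hAF, hFG, hGB⟩
  rcases A.eq_bot_or_eq_of with rfl | ⟨C, v, rfl⟩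
  · obtain ⟨D, v, rfl⟩ := B.eq_bot_or_eq_of.resolve_left (hAF.trans (hFG.trans hGB)).ne'
    refine comparabilityConnected_Ioo_bot ?_ v
    have hAF := rank_strictMono hAF
    have hFG := rank_strictMono hFG
    have hGB := rank_strictMono hGB
    rw [rank_bot] at hAF
    rw [rank_of] at hGB
    lia
  · obtain ⟨F, rfl⟩ := exists_of_eq hAF.le
    obtain ⟨G, rfl⟩ := exists_of_eq (hAF.trans hFG).le
    obtain ⟨D, rfl⟩ := exists_of_eq (hAF.trans (hFG.trans hGB)).le
    have lt_iff := @(ofEmbedding R v).lt_iff_lt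
    rw [← image_Ioo_ofEmbedding]
    exact (isStronglyConnected_finset κ C D ⟨F, G, lt_iff.1 hAF, lt_iff.1 hFG,
      lt_iff.1 hGB⟩).image (ofEmbedding R v).monotone

end ColorFace

end Connectedness

namespace ColorFace

variable (R : κ → V → V → Prop) [IsColorfulGraph R]

theorem isAbstractPolytope [Fintype κ] [Nonempty V] :
    IsAbstractPolytope (ColorFace R) (Fintype.card κ) rank := by
  have grade_bot : grade ℤ (⊥ : ColorFace R) = -1 := rank_bot
  have grade_top : grade ℤ (⊤ : ColorFace R) = Fintype.card κ := rank_top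
  refine ⟨rank_strictMono, ?_, ⟨⊥, rank_bot, fun _ => bot_le⟩, ⟨⊤, rank_top, fun _ => le_top⟩,
    fun Φ => ?_, (isStronglyConnected R).flagsLinked, diamond⟩
  · rw [← grade_bot, ← grade_top]
    have Φ : Flag (ColorFace R) := Classical.arbitrary _
    exact Set.Subset.antisymm (Set.range_subset_iff.2 fun F =>
      ⟨grade_mono (𝕆 := ℤ) (bot_le (a := F)), grade_mono (𝕆 := ℤ) (le_top (a := F))⟩)
      ((bijOn_grade_flag Φ).surjOn.trans (Set.image_subset_range _ _))
  · rw [ncard_flag, grade_bot, grade_top]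
    lia

theorem isSimplePolytope [Fintype κ] :
    IsSimplePolytope (ColorFace R) (Fintype.card κ) (rank (R := R)) := by
  intro F hF
  obtain ⟨v, rfl⟩ := exists_eq_of_empty_of_rank_eq_zero hF
  let f : Finset κ ↪o Set.Ici (of R ∅ v) :=
    (ofEmbedding R v).codRestrict _ fun _ => of_empty_le_iff.2 self_mem_colorComponent
  have hf : Function.Surjective f := fun ⟨G, hG⟩ =>
    (exists_of_eq hG).imp fun _ hD => Subtype.ext hD.symm
  let e : Finset κ ≃o Finset (Fin (Fintype.card κ)) :=
    ⟨(Fintype.equivFin κ).finsetCongr, Finset.map_subset_map⟩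
  exact ⟨(RelIso.ofSurjective f hf).symm.trans e⟩

lemma oneSkeleton_adj_iff {F G : {F : ColorFace R // rank F = 0}} {v w : V}
    (hF : F.1 = of R ∅ v) (hG : G.1 = of R ∅ w) :
    (oneSkeleton (rank (R := R))).Adj F G ↔ v ≠ w ∧ ∃ c, R c v w := by
  change (F ≠ G ∧ ∃ E : ColorFace R, rank E = 1 ∧ F.1 ≤ E ∧ G.1 ≤ E) ↔ _
  rw [Ne, Subtype.ext_iff, hF, hG, (of_empty_injective R).eq_iff]
  refine and_congr_right fun hvw => ⟨?_, ?_⟩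
  · rintro ⟨E, hE, hvE, hwE⟩
    obtain ⟨c, u, rfl⟩ := exists_eq_of_singleton_of_rank_eq_one hE
    obtain ⟨x, hx⟩ := IsColorfulGraph.exists_rel (R := R) c v
    rw [← of_congr (of_empty_le_iff.1 hvE), of_empty_le_iff, coe_of,
      colorComponent_singleton hx] at hwE
    obtain rfl := hwE.resolve_left (Ne.symm hvw)
    exact ⟨c, hx⟩
  · rintro ⟨c, hc⟩
    exact ⟨of R {c} v, by rw [rank_of, Finset.card_singleton, Nat.cast_one],
      of_empty_le_iff.2 self_mem_colorComponent,
      of_empty_le_iff.2 (mem_colorComponent_of_rel (Finset.mem_singleton_self c) hc)⟩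

/-- The isomorphism from an edge-colored graph onto the `1`-skeleton of its polytope. -/
noncomputable def oneSkeletonIso :
    SimpleGraph.fromRel (fun v w => ∃ c, R c v w) ≃g oneSkeleton (rank (R := R)) where
  toEquiv := Equiv.ofBijective (fun v => ⟨of R ∅ v, by rw [rank_of]; rfl⟩)
    ⟨fun _ _ h => of_empty_injective R (congrArg Subtype.val h),
      fun F => (exists_eq_of_empty_of_rank_eq_zero F.2).imp fun _ h => Subtype.ext h.symm⟩
  map_rel_iff' {v w} := by
    refine (oneSkeleton_adj_iff R rfl rfl).trans (and_congr_right fun _ => ?_)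
    exact (or_iff_left_of_imp fun ⟨c, h⟩ => ⟨c, IsColorfulGraph.symm h⟩).symm

lemma oneSkeletonIso_apply (v : V) : (oneSkeletonIso R v).1.1 = {v} := colorComponent_empty

end ColorFace

end ColorfulGraph

/-! ### Cyclic order of the vertices -/

section CircularOrder

/-- The pairs `i`, `k` and `j`, `l` separate each other in the cyclic order; for vertices of
a convex polygon this says that the segments `ik` and `jl` cross. -/
def Interleaved {α : Type*} [SBtw α] (i k j l : α) : Prop :=
  (sbtw i j k ∧ sbtw k l i) ∨ (sbtw i l k ∧ sbtw k j i)

lemma Interleaved.swap_left {α : Type*} [SBtw α] {i j k l : α} (h : Interleaved i k j l) :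
    Interleaved k i j l :=
  h.symm.imp And.symm And.symm

lemma Interleaved.swap_right {α : Type*} [SBtw α] {i j k l : α} (h : Interleaved i k j l) :
    Interleaved i k l j :=
  h.symm

variable {α : Type*} [CircularOrder α] {a b c x : α}

lemma ne_of_sbtw (h : sbtw a b c) : a ≠ b := by
  rintro rfl
  exact sbtw_irrefl_left h

lemma sbtw_or_sbtw_of_ne (hab : a ≠ b) (hbc : b ≠ c) (hca : c ≠ a) : sbtw a b c ∨ sbtw a c b := by
  by_contra! h
  have hcba : btw c b a := btw_iff_not_sbtw.2 h.1
  have habc : btw a b c := (btw_iff_not_sbtw.2 h.2).cyclic_right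
  rcases habc.antisymm hcba with h | h | h
  exacts [hab h, hbc h, hca h]

lemma sbtw_left_or_right_of_ne (h : sbtw a b c) (hx : sbtw a x c) (hne : x ≠ b) :
    sbtw a x b ∨ sbtw b x c := by
  refine (sbtw_or_sbtw_of_ne (ne_of_sbtw hx) hne (ne_of_sbtw h).symm).imp_right fun hb => ?_
  exact (hx.cyclic_left.trans_right hb.cyclic_right).cyclic_right

lemma sbtw_shift {d : α} (h : sbtw a b c) (h' : sbtw c d a) : sbtw b c d :=
  (h'.trans_right h.cyclic_right).cyclic_right

end CircularOrder

section Antipode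

variable {n : ℕ} {d : Sym2 (Fin (2 * n + 4))} {i j k l : Fin (2 * n + 4)}

lemma antipode_val_cases (i : Fin (2 * n + 4)) :
    ((i : ℕ) < n + 2 ∧ (antipode i : ℕ) = i + (n + 2)) ∨
      (n + 2 ≤ (i : ℕ) ∧ (antipode i : ℕ) + (n + 2) = i) := by
  have hval : (antipode i : ℕ) = (i + (n + 2)) % (2 * n + 4) := rfl
  rcases lt_or_ge (i : ℕ) (n + 2) with h | h
  · exact Or.inl ⟨h, hval.trans (Nat.mod_eq_of_lt (by omega))⟩
  · refine Or.inr ⟨h, ?_⟩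
    rw [hval, Nat.mod_eq_sub_mod (by omega), Nat.mod_eq_of_lt (by omega)]
    omega

lemma antipode_antipode (i : Fin (2 * n + 4)) : antipode (antipode i) = i := by
  have h1 := antipode_val_cases i
  have h2 := antipode_val_cases (antipode i)
  omega

lemma antipode_ne (i : Fin (2 * n + 4)) : antipode i ≠ i := by
  have h1 := antipode_val_cases i
  omega

lemma sbtw_antipode (h : sbtw i j k) : sbtw (antipode i) (antipode j) (antipode k) := by
  have h1 := antipode_val_cases i
  have h2 := antipode_val_cases j
  have h3 := antipode_val_cases k
  rw [Fin.sbtw_iff] at *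
  omega

lemma opposite_mk (i j : Fin (2 * n + 4)) : opposite s(i, j) = s(antipode i, antipode j) := rfl

lemma opposite_opposite (d : Sym2 (Fin (2 * n + 4))) : opposite (opposite d) = d := by
  induction d with
  | _ i j => rw [opposite_mk, opposite_mk, antipode_antipode, antipode_antipode]

lemma opposite_injective : Function.Injective (opposite (n := n)) :=
  Function.LeftInverse.injective opposite_opposite

lemma isSide_iff : IsSide s(i, j) ↔ (j : ℕ) = i + 1 ∨ (i : ℕ) = j + 1 ∨
    ((i : ℕ) = 0 ∧ (j : ℕ) = 2 * n + 3) ∨ ((j : ℕ) = 0 ∧ (i : ℕ) = 2 * n + 3) := by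
  have hval (x : Fin (2 * n + 4)) : ((x + 1 : Fin (2 * n + 4)) : ℕ) =
      if (x : ℕ) = 2 * n + 3 then 0 else (x : ℕ) + 1 := by
    rw [Fin.val_add_one]
    simp only [Fin.ext_iff, Fin.val_last]
  have hi := hval i
  have hj := hval j
  constructor
  · rintro ⟨x, hx⟩
    rcases Sym2.eq_iff.1 hx with ⟨rfl, rfl⟩ | ⟨rfl, rfl⟩
    · split_ifs at hi <;> omega
    · split_ifs at hj <;> omega
  · intro h
    by_cases hne : j = i + 1
    · exact ⟨i, by rw [hne]⟩
    · refine ⟨j, Sym2.eq_iff.2 (Or.inr ⟨?_, rfl⟩)⟩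
      rw [Fin.ext_iff] at hne ⊢
      split_ifs at hi hj <;> omega

lemma isSide_opposite (h : IsSide d) : IsSide (opposite d) := by
  obtain ⟨i, rfl⟩ := h
  have h : IsSide s(i, i + 1) := ⟨i, rfl⟩
  rw [isSide_iff] at h
  rw [opposite_mk, isSide_iff]
  have h1 := antipode_val_cases i
  have h2 := antipode_val_cases (i + 1)
  omega

lemma Interleaved.isDiagonal (h : Interleaved i k j l) : IsDiagonal s(i, k) := by
  simp only [Interleaved, Fin.sbtw_iff] at h
  rw [IsDiagonal, Sym2.mk_isDiag_iff, isSide_iff]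
  omega

lemma exists_isSide_sbtw (i : Fin (2 * n + 4)) :
    ∃ j, IsSide s(i, j) ∧ ∀ x, x ≠ i → x ≠ j → sbtw i j x := by
  have hval : ((i + 1 : Fin (2 * n + 4)) : ℕ) = if (i : ℕ) = 2 * n + 3 then 0 else (i : ℕ) + 1 := by
    rw [Fin.val_add_one]
    simp only [Fin.ext_iff, Fin.val_last]
  refine ⟨i + 1, ⟨i, rfl⟩, fun x hxi hxj => ?_⟩
  rw [Ne, Fin.ext_iff] at hxj
  rw [Fin.sbtw_iff]
  split_ifs at hval <;> omega

lemma exists_sbtw_of_isDiagonal (h : IsDiagonal s(i, k)) : ∃ x, sbtw i x k := by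
  obtain ⟨x, hx, hx'⟩ := exists_isSide_sbtw i
  refine ⟨x, hx' k ?_ ?_⟩
  · rintro rfl
    exact h.1 (Sym2.mk_isDiag_iff.2 rfl)
  · rintro rfl
    exact h.2 hx

end Antipode

/-! ### Crossing segments -/

section Area

/-- Twice the signed area of the triangle `pqr`. -/
def area (p q r : ℝ × ℝ) : ℝ := (q.1 - p.1) * (r.2 - p.2) - (q.2 - p.2) * (r.1 - p.1)

lemma area_rotate (p q r : ℝ × ℝ) : area q r p = area p q r := by
  unfold area
  ring

lemma area_swap (p q r : ℝ × ℝ) : area p r q = -area p q r := by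
  unfold area
  ring

lemma area_self_left (p q : ℝ × ℝ) : area p p q = 0 := by
  unfold area
  ring

lemma area_self_right (p q : ℝ × ℝ) : area p q q = 0 := by
  unfold area
  ring

lemma area_add_smul (p q x y : ℝ × ℝ) {a b : ℝ} (hab : a + b = 1) :
    area p q (a • x + b • y) = a * area p q x + b * area p q y := by
  obtain rfl : b = 1 - a := by linarith
  simp only [area, Prod.fst_add, Prod.snd_add, Prod.smul_fst, Prod.smul_snd, smul_eq_mul]
  ring

lemma area_eq_zero_of_mem_openSegment {p q x : ℝ × ℝ} (hx : x ∈ openSegment ℝ p q) :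
    area p q x = 0 := by
  obtain ⟨a, b, -, -, hab, rfl⟩ := hx
  rw [area_add_smul p q p q hab, area_rotate p p q, area_self_left, area_self_right, mul_zero,
    mul_zero, add_zero]

lemma area_cases_of_mem_openSegment {p q r s x : ℝ × ℝ} (hpr : x ∈ openSegment ℝ p r)
    (hqs : x ∈ openSegment ℝ q s) :
    (area p r q < 0 ∧ 0 < area p r s) ∨ (area p r q = 0 ∧ area p r s = 0) ∨
      (0 < area p r q ∧ area p r s < 0) := by
  have h0 := area_eq_zero_of_mem_openSegment hpr
  obtain ⟨a, b, ha, hb, hab, rfl⟩ := hqs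
  rw [area_add_smul p r q s hab] at h0
  rcases lt_trichotomy (area p r q) 0 with h | h | h
  · exact Or.inl ⟨h, by nlinarith⟩
  · rw [h, mul_zero, zero_add] at h0
    exact Or.inr (Or.inl ⟨h, (mul_eq_zero.1 h0).resolve_left hb.ne'⟩)
  · exact Or.inr (Or.inr ⟨h, by nlinarith⟩)

lemma openSegment_inter_nonempty {p q r s : ℝ × ℝ} (hq : area p r q < 0) (hs : 0 < area p r s)
    (hr : area q s r < 0) (hp : 0 < area q s p) :
    (openSegment ℝ p r ∩ openSegment ℝ q s).Nonempty := by
  have hsum : area p r s - area p r q = area q s p - area q s r := by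
    unfold area
    ring
  set D := area p r s - area p r q
  have hD0 : 0 < D := by linarith
  -- Cramer's rule: the point where the lines `pr` and `qs` meet
  refine ⟨(area p r s / D) • q + (-area p r q / D) • s, ?_, ?_⟩
  · refine ⟨-area q s r / D, area q s p / D, div_pos (by linarith) hD0, div_pos hp hD0, ?_, ?_⟩
    · rw [← add_div, div_eq_one_iff_eq hD0.ne', hsum]
      ring
    · have hne := hD0.ne'
      ext
      all_goals
        simp only [Prod.fst_add, Prod.snd_add, Prod.smul_fst, Prod.smul_snd, smul_eq_mul]
        field_simp
        unfold area
        ring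
  · refine ⟨_, _, div_pos hs hD0, div_pos (by linarith) hD0, ?_, rfl⟩
    rw [← add_div, ← sub_eq_add_neg, div_self hD0.ne']

end Area

namespace SymmetricPolygon

variable {n : ℕ} {K : SymmetricPolygon n} {d e : Sym2 (Fin (2 * n + 4))}
  {i j k l : Fin (2 * n + 4)}

lemma area_vertex_pos (h : sbtw i j k) :
    0 < area (K.vertex i) (K.vertex j) (K.vertex k) := by
  rcases h with h | h | h
  · exact K.convex i j k h.1 h.2
  · rw [← area_rotate]
    exact K.convex j k i h.1 h.2
  · rw [area_rotate (K.vertex k)]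
    exact K.convex k i j h.1 h.2

lemma area_vertex_neg (h : sbtw i k j) :
    area (K.vertex i) (K.vertex j) (K.vertex k) < 0 := by
  rw [area_swap, neg_lt_zero]
  exact area_vertex_pos h

lemma area_vertex_eq_zero_iff :
    area (K.vertex i) (K.vertex j) (K.vertex k) = 0 ↔ i = j ∨ j = k ∨ k = i := by
  constructor
  · intro h
    by_contra! hne
    rcases sbtw_or_sbtw_of_ne hne.1 hne.2.1 hne.2.2 with h' | h'
    · exact (area_vertex_pos h').ne' h
    · exact (area_vertex_neg h').ne h
  · rintro (rfl | rfl | rfl)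
    · exact area_self_left _ _
    · exact area_self_right _ _
    · rw [area_rotate, area_self_left]

lemma area_vertex_pos_iff :
    0 < area (K.vertex i) (K.vertex j) (K.vertex k) ↔ sbtw i j k := by
  refine ⟨fun h => ?_, area_vertex_pos⟩
  by_contra hijk
  have hne : ¬ (i = j ∨ j = k ∨ k = i) := fun h' => h.ne' (area_vertex_eq_zero_iff.2 h')
  push Not at hne
  exact h.not_gt (area_vertex_neg ((sbtw_or_sbtw_of_ne hne.1 hne.2.1 hne.2.2).resolve_left hijk))

lemma area_vertex_neg_iff :
    area (K.vertex i) (K.vertex j) (K.vertex k) < 0 ↔ sbtw i k j := by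
  rw [area_swap, neg_lt_zero, area_vertex_pos_iff]

lemma vertex_injective : Function.Injective K.vertex := by
  intro i j hij
  by_contra hne
  have hcard : 3 ≤ ENat.card (Fin (2 * n + 4)) := by
    rw [ENat.card_eq_coe_fintype_card, Fintype.card_fin]
    exact_mod_cast (by omega : 3 ≤ 2 * n + 4)
  obtain ⟨k, hki, hkj⟩ := ENat.exists_ne_ne_of_three_le hcard i j
  have h0 : area (K.vertex i) (K.vertex j) (K.vertex k) = 0 := by rw [hij, area_self_left]
  rcases area_vertex_eq_zero_iff.1 h0 with h | h | h
  exacts [hne h, hkj h.symm, hki h]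

lemma mem_segmentOf {x : ℝ × ℝ} :
    x ∈ K.segmentOf s(i, j) ↔ x ∈ openSegment ℝ (K.vertex i) (K.vertex j) := by
  refine ⟨?_, fun hx => ⟨i, j, rfl, hx⟩⟩
  rintro ⟨a, b, h, hx⟩
  rcases Sym2.eq_iff.1 h with ⟨rfl, rfl⟩ | ⟨rfl, rfl⟩
  · exact hx
  · rwa [openSegment_symm]

lemma eq_of_vertex_mem_openSegment
    (h : K.vertex k ∈ openSegment ℝ (K.vertex i) (K.vertex j)) : i = j := by
  rcases area_vertex_eq_zero_iff.1 (area_eq_zero_of_mem_openSegment h) with h' | rfl | rfl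
  · exact h'
  · exact vertex_injective (right_mem_openSegment_iff.1 h)
  · exact vertex_injective (left_mem_openSegment_iff.1 h)

lemma Crosses.symm (h : K.Crosses d e) : K.Crosses e d :=
  ⟨h.1.symm, Set.inter_comm _ _ ▸ h.2⟩

lemma Crosses.left_ne (h : K.Crosses s(i, k) s(j, l)) : i ≠ k := by
  rintro rfl
  obtain ⟨hne, x, hx, hx'⟩ := h
  rw [mem_segmentOf] at hx hx'
  rw [openSegment_same, Set.mem_singleton_iff] at hx
  subst hx
  obtain rfl := eq_of_vertex_mem_openSegment hx'
  rw [openSegment_same, Set.mem_singleton_iff] at hx'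
  rw [vertex_injective hx'] at hne
  exact hne rfl

lemma Crosses.interleaved (h : K.Crosses s(i, k) s(j, l)) : Interleaved i k j l := by
  have hik := h.left_ne
  have hjl := h.symm.left_ne
  obtain ⟨hne, x, hx, hx'⟩ := h
  rw [mem_segmentOf] at hx hx'
  rcases area_cases_of_mem_openSegment hx hx' with ⟨hj, hl⟩ | ⟨hj, hl⟩ | ⟨hj, hl⟩
  · exact Or.inl ⟨area_vertex_neg_iff.1 hj, (area_vertex_pos_iff.1 hl).cyclic_left⟩
  · rw [area_vertex_eq_zero_iff] at hj hl
    rw [Ne, Sym2.eq_iff] at hne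
    grind
  · exact Or.inr ⟨area_vertex_neg_iff.1 hl, (area_vertex_pos_iff.1 hj).cyclic_left⟩

lemma crosses_of_sbtw (hj : sbtw i j k) (hl : sbtw k l i) : K.Crosses s(i, k) s(j, l) := by
  refine ⟨?_, ?_⟩
  · rw [Ne, Sym2.eq_iff]
    rintro (⟨rfl, -⟩ | ⟨rfl, -⟩)
    · exact sbtw_irrefl_left hj
    · exact sbtw_irrefl_right hl
  · obtain ⟨x, hx, hx'⟩ := openSegment_inter_nonempty (area_vertex_neg (K := K) hj)
      (area_vertex_pos hl.cyclic_right) (area_vertex_neg (sbtw_shift hj hl))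
      (area_vertex_pos (sbtw_shift hl hj).cyclic_right)
    exact ⟨x, mem_segmentOf.2 hx, mem_segmentOf.2 hx'⟩

lemma crosses_iff : K.Crosses s(i, k) s(j, l) ↔ Interleaved i k j l := by
  refine ⟨Crosses.interleaved, ?_⟩
  rintro (⟨hj, hl⟩ | ⟨hl, hj⟩)
  · exact crosses_of_sbtw hj hl
  · rw [Sym2.eq_swap (a := j)]
    exact crosses_of_sbtw hl hj

lemma Crosses.isDiagonal (h : K.Crosses d e) : IsDiagonal d := by
  induction d with
  | _ i k =>
    induction e with
    | _ j l => exact (crosses_iff.1 h).isDiagonal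

lemma center_mem_segmentOf (i : Fin (2 * n + 4)) : K.center ∈ K.segmentOf s(i, antipode i) := by
  rw [mem_segmentOf]
  refine ⟨1 / 2, 1 / 2, by norm_num, by norm_num, by norm_num, ?_⟩
  rw [K.symmetric i, ← smul_add, add_comm (K.vertex i), add_assoc, sub_add_cancel, ← two_smul ℝ,
    smul_smul]
  norm_num

lemma isCentral_iff : K.IsCentral s(i, j) ↔ j = antipode i := by
  refine ⟨fun h => ?_, fun h => h ▸ center_mem_segmentOf i⟩
  by_contra hne
  have hcross : K.Crosses s(i, antipode i) s(i, j) := by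
    refine ⟨?_, K.center, center_mem_segmentOf i, h⟩
    rw [Ne, Sym2.eq_iff]
    rintro (⟨-, h'⟩ | ⟨-, h'⟩)
    · exact hne h'.symm
    · exact antipode_ne i h'
  rcases hcross.interleaved with h' | h'
  · exact sbtw_irrefl_left h'.1
  · exact sbtw_irrefl_right h'.2

lemma isCentral_iff_opposite : K.IsCentral d ↔ opposite d = d := by
  induction d with
  | _ i j =>
    rw [isCentral_iff, opposite_mk, Sym2.eq_iff]
    constructor
    · rintro rfl
      exact Or.inr ⟨rfl, antipode_antipode i⟩
    · rintro (h | h)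
      · exact absurd h.1 (antipode_ne i)
      · exact h.1.symm

end SymmetricPolygon

/-! ### Triangles of a triangulation -/

section CircularOrder

variable {α : Type*} [CircularOrder α] {i j k x y : α}

lemma exists_last_sbtw [Finite α] (p : α → Prop) (hx : sbtw i x k) (hp : p x) :
    ∃ j, sbtw i j k ∧ p j ∧ ∀ y, sbtw j y k → ¬ p y := by
  let r : α → α → Prop := fun b a => sbtw a b k
  have : Std.Irrefl r := ⟨fun _ => sbtw_irrefl_left⟩
  have : IsTrans α r := ⟨fun _ _ _ hba hcb => hcb.trans_left hba⟩
  obtain ⟨j, ⟨hj, hpj⟩, hmax⟩ :=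
    (Finite.wellFounded_of_trans_of_irrefl r).has_min {j | sbtw i j k ∧ p j} ⟨x, hx, hp⟩
  exact ⟨j, hj, hpj, fun y hy hpy => hmax y ⟨hj.trans_left hy, hpy⟩ hy⟩

lemma eq_of_not_interleaved (hj : sbtw i j k) (hx : sbtw i x k) (hy : sbtw k y i)
    (hij : ¬ Interleaved i j x y) (hjk : ¬ Interleaved j k x y) : x = j := by
  by_contra hne
  rcases sbtw_left_or_right_of_ne hj hx hne with h | h
  · exact hij (Or.inl ⟨h, hj.cyclic_left.trans_left hy⟩)
  · exact hjk (Or.inl ⟨h, hy.trans_right hj.cyclic_right⟩)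

end CircularOrder

namespace SymmetricPolygon

variable {n : ℕ} {K : SymmetricPolygon n} {t t' : Finset (Sym2 (Fin (2 * n + 4)))}
  {d d' d'' e : Sym2 (Fin (2 * n + 4))} {i j k l x : Fin (2 * n + 4)}

/-- `d` is an edge of the triangulation with diagonals `t`: one of its diagonals, or a side of the
polygon. -/
def IsEdge (t : Finset (Sym2 (Fin (2 * n + 4)))) (d : Sym2 (Fin (2 * n + 4))) : Prop :=
  d ∈ t ∨ IsSide d

lemma IsEdge.swap (h : IsEdge t s(i, j)) : IsEdge t s(j, i) := by rwa [Sym2.eq_swap]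

lemma not_crosses_of_isSide (hd : IsSide d) : ¬ K.Crosses d e := fun h => h.isDiagonal.2 hd

namespace IsTriangulation

variable (ht : K.IsTriangulation t)

include ht

lemma not_crosses_of_isEdge (hd : IsEdge t d) (he : IsEdge t e) : ¬ K.Crosses d e := by
  rcases hd with hd | hd
  · rcases he with he | he
    · exact ht.not_crosses d hd e he
    · exact fun h => not_crosses_of_isSide he h.symm
  · exact not_crosses_of_isSide hd

lemma not_interleaved (hd : IsEdge t s(i, k)) (he : IsEdge t s(j, l)) : ¬ Interleaved i k j l :=
  fun h => ht.not_crosses_of_isEdge hd he (crosses_iff.2 h)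

lemma not_interleaved_of_last_neighbor (hik : IsEdge t s(i, k)) (hj : sbtw i j k)
    (hij : IsEdge t s(i, j)) (hlast : ∀ y, sbtw j y k → ¬ IsEdge t s(i, y)) {x y}
    (hxy : IsEdge t s(x, y)) : ¬ Interleaved j k x y := by
  have hsbtw {x y} (hxy : IsEdge t s(x, y)) (hx : sbtw j x k) : ¬ sbtw k y j := by
    intro hy
    rcases eq_or_ne y i with rfl | hyi
    · exact hlast x hx hxy.swap
    · rcases sbtw_left_or_right_of_ne hj.cyclic_right hy hyi with h | h
      · exact ht.not_interleaved hik hxy (Or.inl ⟨hj.trans_left hx, h⟩)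
      · exact ht.not_interleaved hij hxy (Or.inr ⟨h, hx.trans_right hj.cyclic_left⟩)
  rintro (⟨hx, hy⟩ | ⟨hy, hx⟩)
  · exact hsbtw hxy hx hy
  · exact hsbtw hxy.swap hy hx

lemma exists_apex (hik : IsEdge t s(i, k)) (hx : sbtw i x k) : ∃ j, sbtw i j k ∧
    IsEdge t s(i, j) ∧ IsEdge t s(j, k) ∧ ∀ y, sbtw j y k → ¬ IsEdge t s(i, y) := by
  obtain ⟨s, hs, hs'⟩ := exists_isSide_sbtw i
  have hsk : sbtw i s k := by
    rcases eq_or_ne x s with rfl | hne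
    · exact hx
    · exact (hs' x (ne_of_sbtw hx).symm hne).trans_right hx
  obtain ⟨j, hj, hij, hlast⟩ := exists_last_sbtw (fun y => IsEdge t s(i, y)) hsk (Or.inr hs)
  refine ⟨j, hj, hij, ?_, hlast⟩
  by_cases hside : IsSide s(j, k)
  · exact Or.inr hside
  have hjk : IsDiagonal s(j, k) :=
    ⟨fun h => ne_of_sbtw hj.cyclic_left (Sym2.mk_isDiag_iff.1 h), hside⟩
  refine Or.inl (ht.maximal _ hjk fun e he hcross => ?_)
  induction e with
  | _ x y =>
    exact ht.not_interleaved_of_last_neighbor hik hj hij hlast (Or.inl he) hcross.interleaved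

lemma apex_unique (hj : sbtw i j k) (hl : sbtw i l k) (hij : IsEdge t s(i, j))
    (hjk : IsEdge t s(j, k)) (hil : IsEdge t s(i, l)) (hlk : IsEdge t s(l, k)) : j = l := by
  by_contra hne
  rcases sbtw_left_or_right_of_ne hj hl (Ne.symm hne) with h | h
  · exact ht.not_interleaved hij hlk (Or.inl ⟨h, hj.cyclic_left⟩)
  · exact ht.not_interleaved hjk hil (Or.inr ⟨h, hj.cyclic_right⟩)

end IsTriangulation

/-- The convex quadrilateral formed by two triangles `ijk` and `kli` with edges in `t`, in which
flips take place. -/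
structure IsQuad (t : Finset (Sym2 (Fin (2 * n + 4)))) (i j k l : Fin (2 * n + 4)) : Prop where
  left : sbtw i j k
  right : sbtw k l i
  ij : IsEdge t s(i, j)
  jk : IsEdge t s(j, k)
  kl : IsEdge t s(k, l)
  li : IsEdge t s(l, i)

namespace IsQuad

lemma interleaved (h : IsQuad t i j k l) : Interleaved i k j l := Or.inl ⟨h.left, h.right⟩

lemma rotate (h : IsQuad t i j k l) : IsQuad t j k l i :=
  ⟨sbtw_shift h.left h.right, sbtw_shift h.right h.left, h.jk, h.kl, h.li, h.ij⟩

lemma imp (h : IsQuad t i j k l)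
    (hij : IsEdge t s(i, j) → IsEdge t' s(i, j)) (hjk : IsEdge t s(j, k) → IsEdge t' s(j, k))
    (hkl : IsEdge t s(k, l) → IsEdge t' s(k, l)) (hli : IsEdge t s(l, i) → IsEdge t' s(l, i)) :
    IsQuad t' i j k l :=
  ⟨h.left, h.right, hij h.ij, hjk h.jk, hkl h.kl, hli h.li⟩

lemma mono (h : IsQuad t i j k l) (htt' : t ⊆ t') : IsQuad t' i j k l :=
  have hsub (e) : IsEdge t e → IsEdge t' e := Or.imp_left fun he => htt' he
  h.imp (hsub _) (hsub _) (hsub _) (hsub _)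

lemma eq_of_crosses (h : IsQuad t i j k l) (he : ∀ f ∈ t, ¬ K.Crosses f e)
    (hc : K.Crosses s(i, k) e) : e = s(j, l) := by
  have hedge {a b x y} (hab : IsEdge t s(a, b)) (hxy : e = s(x, y)) : ¬ Interleaved a b x y := by
    subst hxy
    exact fun hI => hab.elim (fun hab => he _ hab (crosses_iff.2 hI)) hI.isDiagonal.2
  have hends {x y} (hxy : e = s(x, y)) (hx : sbtw i x k) (hy : sbtw k y i) : e = s(j, l) := by
    have hyx : e = s(y, x) := hxy.trans Sym2.eq_swap
    rw [hxy, eq_of_not_interleaved h.left hx hy (hedge h.ij hxy) (hedge h.jk hxy),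
      eq_of_not_interleaved h.right hy hx (hedge h.kl hyx) (hedge h.li hyx)]
  induction e with
  | _ x y =>
    rcases hc.interleaved with ⟨hx, hy⟩ | ⟨hy, hx⟩
    · exact hends rfl hx hy
    · exact hends Sym2.eq_swap hy hx

end IsQuad

lemma flipsTo_iff : K.FlipsTo t d d' ↔
    d ∈ t ∧ ∃ i j k l, d = s(i, k) ∧ d' = s(j, l) ∧ IsQuad t i j k l := by
  refine and_congr_right fun _ => ⟨?_, ?_⟩
  · rintro ⟨i, j, k, l, rfl, rfl, hc, hij, hjk, hkl, hli⟩
    rcases hc.interleaved with ⟨hj, hl⟩ | ⟨hl, hj⟩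
    · exact ⟨i, j, k, l, rfl, rfl, hj, hl, hij, hjk, hkl, hli⟩
    · exact ⟨i, l, k, j, rfl, Sym2.eq_swap, hl, hj, IsEdge.swap hli, IsEdge.swap hkl,
        IsEdge.swap hjk, IsEdge.swap hij⟩
  · rintro ⟨i, j, k, l, rfl, rfl, hq⟩
    exact ⟨i, j, k, l, rfl, rfl, crosses_iff.2 hq.interleaved, hq.ij, hq.jk, hq.kl, hq.li⟩

lemma FlipsTo.crosses (h : K.FlipsTo t d d') : K.Crosses d d' := by
  obtain ⟨-, i, j, k, l, rfl, rfl, hc, -⟩ := h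
  exact hc

namespace IsTriangulation

variable (ht : K.IsTriangulation t)

include ht

lemma exists_flipsTo (hd : d ∈ t) : ∃ d', K.FlipsTo t d d' := by
  induction d with
  | _ i k =>
    have hd' : s(k, i) ∈ t := by rwa [Sym2.eq_swap]
    obtain ⟨x, hx⟩ := exists_sbtw_of_isDiagonal (ht.isDiagonal _ hd)
    obtain ⟨y, hy⟩ := exists_sbtw_of_isDiagonal (ht.isDiagonal _ hd')
    obtain ⟨j, hj, hij, hjk, -⟩ := ht.exists_apex (Or.inl hd) hx
    obtain ⟨l, hl, hkl, hli, -⟩ := ht.exists_apex (Or.inl hd') hy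
    exact ⟨s(j, l), flipsTo_iff.2 ⟨hd, i, j, k, l, rfl, rfl, hj, hl, hij, hjk, hkl, hli⟩⟩

lemma flipsTo_unique (h : K.FlipsTo t d d') (h' : K.FlipsTo t d d'') : d' = d'' := by
  obtain ⟨-, i, j, k, l, rfl, rfl, hq⟩ := flipsTo_iff.1 h
  obtain ⟨-, i', j', k', l', he, rfl, hq'⟩ := flipsTo_iff.1 h'
  rcases Sym2.eq_iff.1 he with ⟨rfl, rfl⟩ | ⟨rfl, rfl⟩
  · rw [ht.apex_unique hq.left hq'.left hq.ij hq.jk hq'.ij hq'.jk,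
      ht.apex_unique hq.right hq'.right hq.kl hq.li hq'.kl hq'.li]
  · rw [ht.apex_unique hq.left hq'.right hq.ij hq.jk hq'.kl hq'.li,
      ht.apex_unique hq.right hq'.left hq.kl hq.li hq'.ij hq'.jk, Sym2.eq_swap]

lemma notMem_of_flipsTo (h : K.FlipsTo t d d') : d' ∉ t :=
  fun hd' => ht.not_crosses d h.1 d' hd' h.crosses

end IsTriangulation

/-! ### Flips of centrally symmetric triangulations -/

/-- The diagonals that stay fixed in the flip of `d` and `opposite d`. -/
def fixedSet (t : Finset (Sym2 (Fin (2 * n + 4)))) (d : Sym2 (Fin (2 * n + 4))) :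
    Finset (Sym2 (Fin (2 * n + 4))) :=
  {e ∈ t | e ≠ d ∧ e ≠ opposite d}

/-- The result of flipping `d` to `d'` and `opposite d` to `opposite d'` in `t`; this is a single
flip if `d` is central. -/
def flipSet (t : Finset (Sym2 (Fin (2 * n + 4)))) (d d' : Sym2 (Fin (2 * n + 4))) :
    Finset (Sym2 (Fin (2 * n + 4))) :=
  fixedSet t d ∪ {d', opposite d'}

lemma mem_fixedSet : e ∈ fixedSet t d ↔ e ∈ t ∧ e ≠ d ∧ e ≠ opposite d := Finset.mem_filter

lemma mem_flipSet : e ∈ flipSet t d d' ↔ e ∈ fixedSet t d ∨ e = d' ∨ e = opposite d' := by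
  rw [flipSet, Finset.mem_union, Finset.mem_insert, Finset.mem_singleton]

lemma mem_flipSet_self : d' ∈ flipSet t d d' := mem_flipSet.2 (Or.inr (Or.inl rfl))

lemma fixedSet_subset_flipSet : fixedSet t d ⊆ flipSet t d d' := Finset.subset_union_left

lemma fixedSet_opposite : fixedSet t (opposite d) = fixedSet t d := by
  ext e
  rw [mem_fixedSet, mem_fixedSet, opposite_opposite, and_comm (a := e ≠ opposite d)]

lemma flipSet_opposite : flipSet t (opposite d) (opposite d') = flipSet t d d' := by
  rw [flipSet, flipSet, fixedSet_opposite, opposite_opposite, Finset.pair_comm]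

lemma ne_of_interleaved (h : Interleaved i k j l) :
    s(i, j) ≠ s(i, k) ∧ s(i, j) ≠ opposite s(i, k) := by
  rw [opposite_mk, Ne, Ne, Sym2.eq_iff, Sym2.eq_iff]
  have h1 := antipode_val_cases i
  have h2 := antipode_val_cases k
  simp only [Interleaved, Fin.sbtw_iff] at h
  omega

lemma IsEdge.fixedSet_of_interleaved (he : IsEdge t s(i, j)) (h : Interleaved i k j l) :
    IsEdge (fixedSet t s(i, k)) s(i, j) :=
  he.imp_left fun he => mem_fixedSet.2 ⟨he, ne_of_interleaved h⟩

lemma IsQuad.fixedSet (h : IsQuad t i j k l) : IsQuad (fixedSet t s(i, k)) i j k l := by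
  have hI := h.interleaved
  have hik : s(k, i) = s(i, k) := Sym2.eq_swap
  exact h.imp (fun he => he.fixedSet_of_interleaved hI)
    (fun he => (hik ▸ he.swap.fixedSet_of_interleaved hI.swap_left).swap)
    (fun he => hik ▸ he.fixedSet_of_interleaved hI.swap_left.swap_right)
    (fun he => (he.swap.fixedSet_of_interleaved hI.swap_right).swap)

namespace FlipsTo

variable (h : K.FlipsTo t d d')

include h

lemma eq_of_crosses (he : ∀ f ∈ fixedSet t d, ¬ K.Crosses f e) (hc : K.Crosses d e) : e = d' := by
  obtain ⟨-, i, j, k, l, rfl, rfl, hq⟩ := flipsTo_iff.1 h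
  exact hq.fixedSet.eq_of_crosses he hc

lemma eq_of_crosses_new (he : ∀ f ∈ fixedSet t d, ¬ K.Crosses f e) (hc : K.Crosses d' e) :
    e = d := by
  obtain ⟨-, i, j, k, l, rfl, rfl, hq⟩ := flipsTo_iff.1 h
  exact (hq.fixedSet.rotate.eq_of_crosses he hc).trans Sym2.eq_swap

lemma reverse : K.FlipsTo (flipSet t d d') d' d := by
  obtain ⟨-, i, j, k, l, rfl, rfl, hq⟩ := flipsTo_iff.1 h
  exact flipsTo_iff.2 ⟨mem_flipSet_self, j, k, l, i, rfl, Sym2.eq_swap,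
    hq.fixedSet.rotate.mono fixedSet_subset_flipSet⟩

lemma map_opposite (hs : ∀ d ∈ t, opposite d ∈ t) : K.FlipsTo t (opposite d) (opposite d') := by
  have hedge {e} (he : IsEdge t e) : IsEdge t (opposite e) := he.imp (hs e) isSide_opposite
  obtain ⟨hd, i, j, k, l, rfl, rfl, hq⟩ := flipsTo_iff.1 h
  exact flipsTo_iff.2 ⟨hs _ hd, _, _, _, _, opposite_mk _ _, opposite_mk _ _,
    sbtw_antipode hq.left, sbtw_antipode hq.right, hedge hq.ij, hedge hq.jk, hedge hq.kl,
    hedge hq.li⟩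

end FlipsTo

/-- A centrally symmetric triangulation, given by its set of diagonals. -/
structure IsSymmetricTriangulation (K : SymmetricPolygon n)
    (t : Finset (Sym2 (Fin (2 * n + 4)))) : Prop extends K.IsTriangulation t where
  symmetric : ∀ d ∈ t, opposite d ∈ t

namespace IsSymmetricTriangulation

variable (ht : IsSymmetricTriangulation K t)

include ht

lemma opposite_mem_iff : opposite d ∈ t ↔ d ∈ t :=
  ⟨fun h => opposite_opposite d ▸ ht.symmetric _ h, ht.symmetric d⟩

lemma flipsTo_ne (h : K.FlipsTo t d d') (he : e ∈ t) : e ≠ d' ∧ e ≠ opposite d' := by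
  refine ⟨?_, ?_⟩ <;> rintro rfl
  · exact ht.notMem_of_flipsTo h he
  · exact ht.notMem_of_flipsTo (h.map_opposite ht.symmetric) he

lemma not_crosses_new_of_mem_fixedSet (h : K.FlipsTo t d d') (he : e ∈ fixedSet t d) :
    ¬ K.Crosses d' e := fun hc =>
  have ⟨het, hed, _⟩ := mem_fixedSet.1 he
  hed (h.eq_of_crosses_new (fun f hf => ht.not_crosses f (mem_fixedSet.1 hf).1 e het) hc)

lemma not_crosses_new_opposite_new (h : K.FlipsTo t d d') : ¬ K.Crosses d' (opposite d') := by
  intro hc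
  refine (ht.flipsTo_ne h h.1).2 (h.eq_of_crosses_new (fun f hf hcf => ?_) hc).symm
  rw [← fixedSet_opposite] at hf
  exact ht.not_crosses_new_of_mem_fixedSet (h.map_opposite ht.symmetric) hf hcf.symm

lemma not_crosses_new (h : K.FlipsTo t d d') (he : e ∈ flipSet t d d') : ¬ K.Crosses d' e := by
  rcases mem_flipSet.1 he with he | rfl | rfl
  · exact ht.not_crosses_new_of_mem_fixedSet h he
  · exact fun hc => hc.1 rfl
  · exact ht.not_crosses_new_opposite_new h

lemma not_crosses_of_mem_flipSet (h : K.FlipsTo t d d') {f} (he : e ∈ flipSet t d d')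
    (hf : f ∈ flipSet t d d') : ¬ K.Crosses e f := by
  have hopp {f} (hf : f ∈ flipSet t d d') : ¬ K.Crosses (opposite d') f :=
    ht.not_crosses_new (h.map_opposite ht.symmetric) (by rwa [flipSet_opposite])
  rcases mem_flipSet.1 he with he' | rfl | rfl
  · rcases mem_flipSet.1 hf with hf' | rfl | rfl
    · exact ht.not_crosses e (mem_fixedSet.1 he').1 f (mem_fixedSet.1 hf').1
    · exact fun hc => ht.not_crosses_new h he hc.symm
    · exact fun hc => hopp he hc.symm
  · exact ht.not_crosses_new h hf
  · exact hopp hf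

lemma mem_flipSet_of_not_crosses (h : K.FlipsTo t d d') (he : IsDiagonal e)
    (hc : ∀ f ∈ flipSet t d d', ¬ K.Crosses e f) : e ∈ flipSet t d d' := by
  have hopp := h.map_opposite ht.symmetric
  have hfixed : ∀ f ∈ fixedSet t d, ¬ K.Crosses f e :=
    fun f hf hcf => hc f (fixedSet_subset_flipSet hf) hcf.symm
  by_cases hde : K.Crosses d e
  · exact mem_flipSet.2 (Or.inr (Or.inl (h.eq_of_crosses hfixed hde)))
  by_cases hde' : K.Crosses (opposite d) e
  · rw [← fixedSet_opposite] at hfixed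
    exact mem_flipSet.2 (Or.inr (Or.inr (hopp.eq_of_crosses hfixed hde')))
  have het : e ∈ t := by
    refine ht.maximal e he fun f hf hcf => ?_
    by_cases hfd : f = d
    · exact hde (hfd ▸ hcf.symm)
    by_cases hfd' : f = opposite d
    · exact hde' (hfd' ▸ hcf.symm)
    exact hfixed f (mem_fixedSet.2 ⟨hf, hfd, hfd'⟩) hcf.symm
  refine mem_flipSet.2 (Or.inl (mem_fixedSet.2 ⟨het, ?_, ?_⟩)) <;> rintro rfl
  · exact hc d' mem_flipSet_self h.crosses
  · exact hc _ (flipSet_opposite (t := t) ▸ mem_flipSet_self) hopp.crosses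

lemma of_flipsTo (h : K.FlipsTo t d d') : IsSymmetricTriangulation K (flipSet t d d') where
  isDiagonal e he := by
    rcases mem_flipSet.1 he with he | rfl | rfl
    · exact ht.isDiagonal e (mem_fixedSet.1 he).1
    · exact h.crosses.symm.isDiagonal
    · exact (h.map_opposite ht.symmetric).crosses.symm.isDiagonal
  not_crosses _ he _ hf := ht.not_crosses_of_mem_flipSet h he hf
  maximal _ he hc := ht.mem_flipSet_of_not_crosses h he hc
  symmetric e he := by
    rw [mem_flipSet, mem_fixedSet] at he
    rw [← flipSet_opposite, mem_flipSet, mem_fixedSet]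
    exact he.imp (fun ⟨h1, h2, h3⟩ => ⟨ht.symmetric e h1, opposite_injective.ne h2,
      opposite_injective.ne h3⟩) (Or.imp (congrArg opposite) (congrArg opposite))

lemma isCentral_of_flipsTo (h : K.FlipsTo t d d') (hd : K.IsCentral d) : K.IsCentral d' := by
  rw [isCentral_iff_opposite] at *
  have hopp := h.map_opposite ht.symmetric
  rw [hd] at hopp
  exact ht.flipsTo_unique hopp h

end IsSymmetricTriangulation

lemma mem_fixedSet_or (he : e ∈ t) : e ∈ fixedSet t d ∨ e = d ∨ e = opposite d := by
  rw [mem_fixedSet]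
  tauto

/-- The map that replaces `d` by `d'` and `opposite d` by `opposite d'`; it carries the diagonals of
a triangulation to those of the flipped one. -/
def exchange (d d' e : Sym2 (Fin (2 * n + 4))) : Sym2 (Fin (2 * n + 4)) :=
  if e = d then d' else if e = opposite d then opposite d' else e

lemma exchange_self : exchange d d' d = d' := if_pos rfl

lemma exchange_of_mem_fixedSet (he : e ∈ fixedSet t d) : exchange d d' e = e := by
  have ⟨_, hd, hd'⟩ := mem_fixedSet.1 he
  rw [exchange, if_neg hd, if_neg hd']

namespace IsSymmetricTriangulation

variable (ht : IsSymmetricTriangulation K t) (h : K.FlipsTo t d d')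

include ht

lemma opposite_mem_fixedSet (he : e ∈ fixedSet t d) : opposite e ∈ fixedSet t d := by
  rw [← fixedSet_opposite]
  have ⟨het, hd, hd'⟩ := mem_fixedSet.1 he
  exact mem_fixedSet.2 ⟨ht.symmetric e het, opposite_injective.ne hd, opposite_injective.ne hd'⟩

include h

lemma fixedSet_flipSet : fixedSet (flipSet t d d') d' = fixedSet t d := by
  ext e
  rw [mem_fixedSet, mem_flipSet]
  refine ⟨by tauto, fun he => ⟨Or.inl he, ht.flipsTo_ne h (mem_fixedSet.1 he).1⟩⟩

lemma flipSet_flipSet : flipSet (flipSet t d d') d' d = t := by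
  ext e
  rw [mem_flipSet, ht.fixedSet_flipSet h]
  refine ⟨?_, mem_fixedSet_or⟩
  rintro (he | rfl | rfl)
  exacts [(mem_fixedSet.1 he).1, h.1, ht.symmetric _ h.1]

lemma exchange_opposite_self : exchange d d' (opposite d) = opposite d' := by
  by_cases hd : opposite d = d
  · have hd' := isCentral_iff_opposite.1 (ht.isCentral_of_flipsTo h (isCentral_iff_opposite.2 hd))
    rw [hd, hd', exchange_self]
  · rw [exchange, if_neg hd, if_pos rfl]

lemma exchange_mem (he : e ∈ t) : exchange d d' e ∈ flipSet t d d' := by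
  rw [mem_flipSet]
  rcases mem_fixedSet_or (d := d) he with he | rfl | rfl
  · exact Or.inl (by rwa [exchange_of_mem_fixedSet he])
  · exact Or.inr (Or.inl exchange_self)
  · exact Or.inr (Or.inr (ht.exchange_opposite_self h))

lemma exchange_map_opposite (he : e ∈ t) :
    exchange d d' (opposite e) = opposite (exchange d d' e) := by
  rcases mem_fixedSet_or (d := d) he with he | rfl | rfl
  · rw [exchange_of_mem_fixedSet he, exchange_of_mem_fixedSet (ht.opposite_mem_fixedSet he)]
  · rw [exchange_self, ht.exchange_opposite_self h]
  · rw [ht.exchange_opposite_self h, opposite_opposite, opposite_opposite, exchange_self]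

lemma exchange_opposite_opposite (he : e ∈ t) :
    exchange (opposite d) (opposite d') e = exchange d d' e := by
  rcases mem_fixedSet_or (d := d) he with he | rfl | rfl
  · rw [exchange_of_mem_fixedSet he, exchange_of_mem_fixedSet (t := t)]
    rwa [fixedSet_opposite]
  · have hopp := ht.exchange_opposite_self (h.map_opposite ht.symmetric)
    rw [opposite_opposite, opposite_opposite] at hopp
    rw [hopp, exchange_self]
  · rw [exchange_self, ht.exchange_opposite_self h]

lemma exchange_exchange (he : e ∈ t) : exchange d' d (exchange d d' e) = e := by
  rcases mem_fixedSet_or (d := d) he with he | rfl | rfl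
  · rw [exchange_of_mem_fixedSet he, exchange_of_mem_fixedSet (ht.fixedSet_flipSet h ▸ he)]
  · rw [exchange_self, exchange_self]
  · rw [ht.exchange_opposite_self h, (ht.of_flipsTo h).exchange_opposite_self h.reverse]

lemma exchange_eq_iff {f} (he : e ∈ t) (hf : f ∈ t) :
    exchange d d' e = exchange d d' f ↔ e = f := by
  refine ⟨fun hef => ?_, congrArg _⟩
  rw [← ht.exchange_exchange h he, hef, ht.exchange_exchange h hf]

lemma isCentral_exchange_iff (he : e ∈ t) : K.IsCentral (exchange d d' e) ↔ K.IsCentral e := by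
  rw [isCentral_iff_opposite, isCentral_iff_opposite, ← ht.exchange_map_opposite h he,
    ht.exchange_eq_iff h (ht.symmetric e he) he]

end IsSymmetricTriangulation

/-! ### Flips of colored triangulations -/

namespace ColoredTriangulation

variable (T : K.ColoredTriangulation) {T' : K.ColoredTriangulation}

lemma isSymmetricTriangulation : IsSymmetricTriangulation K T.diagonals :=
  { T.isTriangulation with symmetric := T.symmetric }

lemma color_opposite (d : Sym2 (Fin (2 * n + 4))) : T.color (opposite d) = T.color d := by
  by_cases hc : K.IsCentral d
  · rw [isCentral_iff_opposite.1 hc]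
  have hc' : ¬ K.IsCentral (opposite d) := by
    rw [isCentral_iff_opposite] at hc ⊢
    exact opposite_injective.ne hc
  by_cases hd : d ∈ T.diagonals
  · exact (T.color_eq_iff _ (T.symmetric d hd) _ hd hc' hc).2 (Or.inr rfl)
  · rw [(T.color_eq_none_iff d).2 (Or.inl hd), (T.color_eq_none_iff _).2 (Or.inl ?_)]
    rwa [T.isSymmetricTriangulation.opposite_mem_iff]

/-- `d` is a diagonal of `T` of the color `c`, where `none` stands for the extra color; the second
condition alone would allow any `d ∉ T.diagonals` if `c = none`. -/
def HasColor (d : Sym2 (Fin (2 * n + 4))) (c : Option (Fin n)) : Prop :=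
  d ∈ T.diagonals ∧ T.color d = c

variable {T}

lemma color_eq_none_iff_isCentral (hd : d ∈ T.diagonals) : T.color d = none ↔ K.IsCentral d := by
  rw [T.color_eq_none_iff, or_iff_right (not_not_intro hd)]

lemma eq_or_eq_opposite_of_color_eq (hd : d ∈ T.diagonals) (he : e ∈ T.diagonals)
    (h : T.color d = T.color e) : d = e ∨ d = opposite e := by
  have hiff : K.IsCentral d ↔ K.IsCentral e := by
    rw [← color_eq_none_iff_isCentral hd, h, color_eq_none_iff_isCentral he]
  by_cases hdc : K.IsCentral d
  · refine Or.inl (not_not.1 fun hne => ?_)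
    exact T.isTriangulation.not_crosses d hd e he ⟨hne, K.center, hdc, hiff.1 hdc⟩
  · exact (T.color_eq_iff d hd e he hdc (mt hiff.2 hdc)).1 h

lemma ext_of_mem (hdiag : T.diagonals = T'.diagonals)
    (hcolor : ∀ e ∈ T.diagonals, T.color e = T'.color e) : T = T' := by
  have hcolor' : T.color = T'.color := by
    funext e
    by_cases he : e ∈ T.diagonals
    · exact hcolor e he
    · rw [(T.color_eq_none_iff e).2 (Or.inl he),
        (T'.color_eq_none_iff e).2 (Or.inl (hdiag ▸ he))]
  cases T
  cases T'
  cases hdiag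
  cases hcolor'
  rfl

/-- The color-preserving flip of a diagonal and its opposite. -/
def flip (T : K.ColoredTriangulation) (h : K.FlipsTo T.diagonals d d') :
    K.ColoredTriangulation :=
  have ht := T.isSymmetricTriangulation
  have ht' := ht.of_flipsTo h
  have hmem {e} (he : e ∈ flipSet T.diagonals d d') : exchange d' d e ∈ T.diagonals := by
    rw [← ht.flipSet_flipSet h]
    exact ht'.exchange_mem h.reverse he
  { diagonals := flipSet T.diagonals d d'
    isTriangulation := ht'.toIsTriangulation
    symmetric := ht'.symmetric
    color := fun e => if e ∈ flipSet T.diagonals d d' then T.color (exchange d' d e) else none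
    color_eq_none_iff := fun e => by
      split_ifs with he
      · rw [color_eq_none_iff_isCentral (hmem he), ht'.isCentral_exchange_iff h.reverse he,
          or_iff_right (not_not_intro he)]
      · exact iff_of_true rfl (Or.inl he)
    color_eq_iff := fun e he f hf hec hfc => by
      rw [if_pos he, if_pos hf, T.color_eq_iff _ (hmem he) _ (hmem hf)
        (mt (ht'.isCentral_exchange_iff h.reverse he).1 hec)
        (mt (ht'.isCentral_exchange_iff h.reverse hf).1 hfc),
        ← ht'.exchange_map_opposite h.reverse hf, ht'.exchange_eq_iff h.reverse he hf,
        ht'.exchange_eq_iff h.reverse he (ht'.symmetric f hf)] }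

section flip

variable (h : K.FlipsTo T.diagonals d d')

lemma diagonals_flip : (T.flip h).diagonals = flipSet T.diagonals d d' := rfl

lemma color_flip (he : e ∈ flipSet T.diagonals d d') :
    (T.flip h).color e = T.color (exchange d' d e) := if_pos he

lemma color_flip_self : (T.flip h).color d' = T.color d := by
  rw [color_flip h mem_flipSet_self, exchange_self]

lemma color_flip_of_mem_fixedSet (he : e ∈ fixedSet T.diagonals d) :
    (T.flip h).color e = T.color e := by
  rw [color_flip h (fixedSet_subset_flipSet he),
    exchange_of_mem_fixedSet (T.isSymmetricTriangulation.fixedSet_flipSet h ▸ he)]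

lemma hasColor_flip_of_mem_fixedSet {c} (he : e ∈ fixedSet T.diagonals d) (hc : T.HasColor e c) :
    (T.flip h).HasColor e c :=
  ⟨fixedSet_subset_flipSet he, (color_flip_of_mem_fixedSet h he).trans hc.2⟩

lemma flip_reverse : (T.flip h).flip h.reverse = T := by
  have ht := T.isSymmetricTriangulation
  refine ext_of_mem (ht.flipSet_flipSet h) fun e he => ?_
  have he' : e ∈ T.diagonals := ht.flipSet_flipSet h ▸ he
  rw [color_flip h.reverse he, color_flip h (ht.exchange_mem h he'), ht.exchange_exchange h he']

lemma flip_opposite (h' : K.FlipsTo T.diagonals (opposite d) (opposite d')) :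
    T.flip h' = T.flip h := by
  refine ext_of_mem flipSet_opposite fun e he => ?_
  have he' : e ∈ flipSet T.diagonals d d' := flipSet_opposite ▸ he
  rw [color_flip h' he, color_flip h he',
    (T.isSymmetricTriangulation.of_flipsTo h).exchange_opposite_opposite h.reverse he']

end flip

end ColoredTriangulation

open ColoredTriangulation

variable {T T' T'' : K.ColoredTriangulation} {c c' : Option (Fin n)}

lemma flip_iff : Flip c T T' ↔
    ∃ d d', ∃ h : K.FlipsTo T.diagonals d d', T.color d = c ∧ T' = T.flip h := by
  constructor
  · rintro ⟨d, d', h, hc, hmem, hc', hcolor⟩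
    have hdiag : T'.diagonals = flipSet T.diagonals d d' := by
      ext e
      rw [hmem, mem_flipSet, mem_fixedSet]
    refine ⟨d, d', h, hc, ext_of_mem hdiag fun e he => ?_⟩
    rcases mem_flipSet.1 (hdiag ▸ he) with he | rfl | rfl
    · have ⟨het, hd, hd'⟩ := mem_fixedSet.1 he
      rw [hcolor e het hd hd', color_flip_of_mem_fixedSet h he]
    · rw [hc', color_flip_self, hc]
    · rw [color_opposite, color_opposite, hc', color_flip_self, hc]
  · rintro ⟨d, d', h, hc, rfl⟩
    refine ⟨d, d', h, hc, fun e => ?_, (color_flip_self h).trans hc, fun e he hd hd' =>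
      color_flip_of_mem_fixedSet h (mem_fixedSet.2 ⟨he, hd, hd'⟩)⟩
    rw [diagonals_flip, mem_flipSet, mem_fixedSet]

lemma Flip.symm (h : Flip c T T') : Flip c T' T := by
  obtain ⟨d, d', hd, hc, rfl⟩ := flip_iff.1 h
  exact flip_iff.2 ⟨d', d, hd.reverse, (color_flip_self hd).trans hc, (flip_reverse hd).symm⟩

lemma Flip.unique (h : Flip c T T') (h' : Flip c T T'') : T' = T'' := by
  obtain ⟨d, d', hd, hc, rfl⟩ := flip_iff.1 h
  obtain ⟨e, e', he, hc', rfl⟩ := flip_iff.1 h'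
  have ht := T.isSymmetricTriangulation
  rcases eq_or_eq_opposite_of_color_eq hd.1 he.1 (hc.trans hc'.symm) with rfl | rfl
  · obtain rfl := ht.flipsTo_unique hd he
    rfl
  · obtain rfl := ht.flipsTo_unique hd (he.map_opposite ht.symmetric)
    exact flip_opposite he hd

lemma Flip.hasColor (h : Flip c T T') (he : T.HasColor e c') (hne : c' ≠ c) :
    T'.HasColor e c' := by
  obtain ⟨d, d', hd, hc, rfl⟩ := flip_iff.1 h
  refine hasColor_flip_of_mem_fixedSet hd (mem_fixedSet.2 ⟨he.1, ?_, ?_⟩) he <;> rintro rfl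
  · exact hne (he.2.symm.trans hc)
  · exact hne (he.2.symm.trans ((T.color_opposite d).trans hc))

lemma Flip.notMem_faceSet {D : Finset (Option (Fin n))} (h : Flip c T T') (hc : c ∉ D) :
    T' ∉ faceSet D T := by
  intro hT'
  obtain ⟨d, d', hd, hdc, rfl⟩ := flip_iff.1 h
  have hstay (S) (hS : S ∈ faceSet D T) : S.HasColor d c := by
    induction hS with
    | refl => exact ⟨hd.1, hdc⟩
    | tail _ hab ih =>
      obtain ⟨c', hc', hab⟩ := hab
      exact hab.hasColor ih (ne_of_mem_of_not_mem hc' hc).symm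
  have hmem : d ∈ flipSet T.diagonals d d' := (hstay _ hT').1
  have hne := T.isSymmetricTriangulation.flipsTo_ne hd hd.1
  rw [mem_flipSet, mem_fixedSet] at hmem
  tauto

lemma flip_flip (h : K.FlipsTo T.diagonals d d') : Flip (T.color d) T (T.flip h) :=
  flip_iff.2 ⟨d, d', h, rfl, rfl⟩

lemma ColoredTriangulation.HasColor.exists_flip (hd : T.HasColor d c) : ∃ T', Flip c T T' :=
  have ⟨_, h⟩ := T.isTriangulation.exists_flipsTo hd.1
  ⟨T.flip h, hd.2 ▸ flip_flip h⟩

end SymmetricPolygon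

/-! ### The fan at a vertex -/

namespace SymmetricPolygon

variable {n : ℕ} {K : SymmetricPolygon n} {d e : Sym2 (Fin (2 * n + 4))}
  {j x y : Fin (2 * n + 4)} {c c' : Option (Fin n)}

lemma val_antipode_zero : ((antipode 0 : Fin (2 * n + 4)) : ℕ) = n + 2 := by
  have := antipode_val_cases (0 : Fin (2 * n + 4))
  rw [Fin.val_zero] at this
  omega

/-- The vertices `2, …, n + 1` and the antipode of `0`, that is `n + 2`, to which a fan at `0` has
its diagonals in the half polygon `0, …, n + 2`. They are indexed by the colors that the diagonals
have in a standard fan. -/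
def fanVertex (c : Option (Fin n)) : Fin (2 * n + 4) :=
  ⟨c.elim n (↑) + 2, by cases c <;> simp only [Option.elim] <;> omega⟩

lemma val_fanVertex_some (m : Fin n) : (fanVertex (some m) : ℕ) = m + 2 := rfl

lemma fanVertex_none : fanVertex (none : Option (Fin n)) = antipode 0 :=
  Fin.ext val_antipode_zero.symm

lemma val_fanVertex_mem (c : Option (Fin n)) : (fanVertex c : ℕ) ∈ Set.Icc 2 (n + 2) := by
  cases c with
  | none => rw [fanVertex_none, val_antipode_zero, Set.mem_Icc]; omega
  | some m => rw [val_fanVertex_some, Set.mem_Icc]; omega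

lemma exists_fanVertex_eq (hj : (j : ℕ) ∈ Set.Icc 2 (n + 2)) : ∃ c, fanVertex c = j := by
  rw [Set.mem_Icc] at hj
  by_cases hjn : (j : ℕ) = n + 2
  · exact ⟨none, Fin.ext hjn.symm⟩
  · exact ⟨some ⟨j - 2, by omega⟩, Fin.ext (Nat.sub_add_cancel hj.1)⟩

lemma fanVertex_injective : Function.Injective (fanVertex (n := n)) := by
  intro c c' h
  rw [Fin.ext_iff] at h
  cases c <;> cases c' <;>
    simp only [fanVertex_none, val_fanVertex_some, val_antipode_zero] at h <;> grind

/-- The diagonals of the fan at the vertex `0` in one half of the polygon. -/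
def fanDiagonal (c : Option (Fin n)) : Sym2 (Fin (2 * n + 4)) := s(0, fanVertex c)

lemma fanDiagonal_injective : Function.Injective (fanDiagonal (n := n)) :=
  fun _ _ h => fanVertex_injective (Sym2.congr_right.1 h)

lemma eq_of_fanDiagonal_eq_opposite (h : fanDiagonal c = opposite (fanDiagonal c')) : c = c' := by
  have h1 := antipode_val_cases (fanVertex c')
  have h2 := val_antipode_zero (n := n)
  have ⟨h3, _⟩ := val_fanVertex_mem c
  have ⟨h4, _⟩ := val_fanVertex_mem c'
  refine fanVertex_injective (Fin.ext ?_)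
  simp only [fanDiagonal, opposite_mk, Sym2.eq_iff, Fin.ext_iff, Fin.val_zero] at h
  omega

lemma opposite_eq_iff : opposite d = e ↔ d = opposite e := by
  rw [← opposite_injective.eq_iff, opposite_opposite]

lemma fanDiagonal_unique (h : e = fanDiagonal c ∨ e = opposite (fanDiagonal c))
    (h' : e = fanDiagonal c' ∨ e = opposite (fanDiagonal c')) : c = c' := by
  rcases h with rfl | rfl
  · exact h'.elim (fun h' => fanDiagonal_injective h') eq_of_fanDiagonal_eq_opposite
  · rw [opposite_eq_iff, opposite_injective.eq_iff] at h'
    exact h'.elim eq_of_fanDiagonal_eq_opposite fun h' => fanDiagonal_injective h'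

lemma isCentral_fanDiagonal_iff : K.IsCentral (fanDiagonal c) ↔ c = none := by
  rw [fanDiagonal, isCentral_iff, ← fanVertex_none, fanVertex_injective.eq_iff]

lemma isCentral_opposite_iff : K.IsCentral (opposite e) ↔ K.IsCentral e := by
  rw [isCentral_iff_opposite, isCentral_iff_opposite, opposite_injective.eq_iff]

/-- The centrally symmetric triangulation formed by the fan at the vertex `0` in one half of the
polygon and by its image. -/
def fanSet (n : ℕ) : Finset (Sym2 (Fin (2 * n + 4))) :=
  Finset.univ.image fanDiagonal ∪ Finset.univ.image fun c => opposite (fanDiagonal c)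

lemma mem_fanSet : e ∈ fanSet n ↔ ∃ c, e = fanDiagonal c ∨ e = opposite (fanDiagonal c) := by
  simp only [fanSet, Finset.mem_union, Finset.mem_image, Finset.mem_univ, true_and, exists_or,
    eq_comm (a := e)]

lemma opposite_mem_fanSet (h : e ∈ fanSet n) : opposite e ∈ fanSet n := by
  obtain ⟨c, rfl | rfl⟩ := mem_fanSet.1 h
  · exact mem_fanSet.2 ⟨c, Or.inr rfl⟩
  · exact mem_fanSet.2 ⟨c, Or.inl (opposite_opposite _)⟩

lemma mk_zero_mem_fanSet (hj : (j : ℕ) ∈ Set.Icc 2 (n + 2)) : s(0, j) ∈ fanSet n := by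
  obtain ⟨c, rfl⟩ := exists_fanVertex_eq hj
  exact mem_fanSet.2 ⟨c, Or.inl rfl⟩

lemma mk_antipode_zero_mem_fanSet (hj : n + 4 ≤ (j : ℕ)) : s(antipode 0, j) ∈ fanSet n := by
  have hj' : (antipode j : ℕ) ∈ Set.Icc 2 (n + 2) := by
    have := antipode_val_cases j
    rw [Set.mem_Icc]
    omega
  have := opposite_mem_fanSet (mk_zero_mem_fanSet hj')
  rwa [opposite_mk, antipode_antipode] at this

lemma mk_mem_fanSet_of_not_crosses (hxy : x < y) (hd : IsDiagonal s(x, y))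
    (h : ∀ f ∈ fanSet n, ¬ K.Crosses s(x, y) f) : s(x, y) ∈ fanSet n := by
  have hN := val_antipode_zero (n := n)
  have h0 : ((0 : Fin (2 * n + 4)) : ℕ) = 0 := Fin.val_zero _
  have hside := hd.2
  rw [isSide_iff] at hside
  have hlow (z) (hz : z < 2 * n + 4) (h2 : 2 ≤ z) (hzn : z ≤ n + 2) :
      ¬ Interleaved x y 0 ⟨z, hz⟩ :=
    fun hc => h _ (mk_zero_mem_fanSet ⟨h2, hzn⟩) (crosses_iff.2 hc)
  have hhigh (z) (hz : z < 2 * n + 4) (hzn : n + 4 ≤ z) : ¬ Interleaved x y (antipode 0) ⟨z, hz⟩ :=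
    fun hc => h _ (mk_antipode_zero_mem_fanSet hzn) (crosses_iff.2 hc)
  simp only [Interleaved, Fin.sbtw_iff, Fin.lt_def, h0, hN] at hxy hlow hhigh
  rcases Nat.eq_zero_or_pos x with hx0 | hx0
  · obtain rfl : x = 0 := Fin.ext hx0
    refine mk_zero_mem_fanSet ⟨by omega, ?_⟩
    by_contra! hlt
    have := hhigh (2 * n + 3) (by omega) (by omega)
    omega
  by_cases hyN : (y : ℕ) ≤ n + 2
  · have := hlow (x + 1) (by omega) (by omega) (by omega)
    omega
  rcases lt_trichotomy (x : ℕ) (n + 2) with hxN | hxN | hxN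
  · have := hlow (n + 2) (by omega) (by omega) (by omega)
    omega
  · obtain rfl : x = antipode 0 := Fin.ext (by omega)
    exact mk_antipode_zero_mem_fanSet (by omega)
  · have := hhigh (x + 1) (by omega) (by omega)
    omega

lemma mem_fanSet_of_not_crosses (he : IsDiagonal e) (h : ∀ f ∈ fanSet n, ¬ K.Crosses e f) :
    e ∈ fanSet n := by
  induction e with
  | _ x y =>
    rcases lt_or_gt_of_ne (fun hxy => he.1 (Sym2.mk_isDiag_iff.2 hxy)) with hlt | hlt
    · exact mk_mem_fanSet_of_not_crosses hlt he h
    · rw [Sym2.eq_swap] at *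
      exact mk_mem_fanSet_of_not_crosses hlt he h

lemma isDiagonal_of_mem_fanSet (h : e ∈ fanSet n) : IsDiagonal e := by
  obtain ⟨c, rfl | rfl⟩ := mem_fanSet.1 h
  all_goals
    have ⟨h1, h2⟩ := val_fanVertex_mem c
    have h3 := antipode_val_cases (fanVertex c)
    have h4 := val_antipode_zero (n := n)
    rw [fanDiagonal, IsDiagonal]
    simp only [opposite_mk, Sym2.mk_isDiag_iff, isSide_iff, Fin.ext_iff, Fin.val_zero]
    omega

lemma not_crosses_of_mem_fanSet (he : e ∈ fanSet n) (hf : d ∈ fanSet n) : ¬ K.Crosses e d := by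
  obtain ⟨c, rfl | rfl⟩ := mem_fanSet.1 he <;> obtain ⟨c', rfl | rfl⟩ := mem_fanSet.1 hf
  all_goals
    have ⟨h1, h2⟩ := val_fanVertex_mem c
    have ⟨h3, h4⟩ := val_fanVertex_mem c'
    have h5 := antipode_val_cases (fanVertex c)
    have h6 := antipode_val_cases (fanVertex c')
    have h7 := val_antipode_zero (n := n)
    rw [fanDiagonal, fanDiagonal]
    simp only [opposite_mk, crosses_iff, Interleaved, Fin.sbtw_iff, Fin.lt_def, Fin.val_zero]
    omega

lemma isTriangulation_fanSet : K.IsTriangulation (fanSet n) where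
  isDiagonal _ := isDiagonal_of_mem_fanSet
  not_crosses _ he _ hf := not_crosses_of_mem_fanSet he hf
  maximal _ := mem_fanSet_of_not_crosses

open Classical in
/-- The coloring of the standard fan, whose diagonal `fanDiagonal c` has the color `c`. -/
noncomputable def fanColor (e : Sym2 (Fin (2 * n + 4))) : Option (Fin n) :=
  if h : ∃ c, e = fanDiagonal c ∨ e = opposite (fanDiagonal c) then h.choose else none

lemma fanColor_eq (h : e = fanDiagonal c ∨ e = opposite (fanDiagonal c)) : fanColor e = c := by
  have hex : ∃ c, e = fanDiagonal c ∨ e = opposite (fanDiagonal c) := ⟨c, h⟩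
  rw [fanColor, dif_pos hex]
  exact fanDiagonal_unique hex.choose_spec h

/-- The standard fan, which contains the diagonals `fanDiagonal c`, colored by `c`. -/
noncomputable def fan (K : SymmetricPolygon n) : K.ColoredTriangulation where
  diagonals := fanSet n
  isTriangulation := isTriangulation_fanSet
  symmetric _ := opposite_mem_fanSet
  color := fanColor
  color_eq_none_iff e := by
    by_cases he : e ∈ fanSet n
    · obtain ⟨c, hc⟩ := mem_fanSet.1 he
      rw [or_iff_right (not_not_intro he), fanColor_eq hc]
      rcases hc with rfl | rfl
      · exact isCentral_fanDiagonal_iff.symm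
      · rw [isCentral_opposite_iff, isCentral_fanDiagonal_iff]
    · exact iff_of_true (dif_neg (mt mem_fanSet.2 he)) (Or.inl he)
  color_eq_iff e he f hf _ _ := by
    obtain ⟨c, hc⟩ := mem_fanSet.1 he
    obtain ⟨c', hc'⟩ := mem_fanSet.1 hf
    rw [fanColor_eq hc, fanColor_eq hc']
    constructor
    · rintro rfl
      rcases hc with rfl | rfl <;> rcases hc' with rfl | rfl <;> simp [opposite_opposite]
    · rintro (rfl | rfl)
      · exact fanDiagonal_unique hc hc'
      · rw [opposite_eq_iff, opposite_injective.eq_iff] at hc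
        exact fanDiagonal_unique hc.symm hc'

end SymmetricPolygon

/-! ### Reaching a fan -/

open Relation in
lemma exists_reflTransGen_of_wellFoundedGT {α β : Type*} [Preorder β] [WellFoundedGT β]
    {r : α → α → Prop} {P Q : α → Prop} (f : α → β)
    (step : ∀ a, Q a → ¬ P a → ∃ b, r a b ∧ Q b ∧ f a < f b) (a : α) (ha : Q a) :
    ∃ b, ReflTransGen r a b ∧ Q b ∧ P b := by
  induction hs : f a using WellFoundedGT.induction generalizing a with
  | _ s ih =>
    by_cases hP : P a
    · exact ⟨a, ReflTransGen.refl, ha, hP⟩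
    · obtain ⟨b, hab, hb, hlt⟩ := step a ha hP
      obtain ⟨c, hbc, hc⟩ := ih _ (hs ▸ hlt) b hb rfl
      exact ⟨c, hbc.head hab, hc⟩

namespace SymmetricPolygon

open ColoredTriangulation

variable {n : ℕ} {K : SymmetricPolygon n} {T T' T'' : K.ColoredTriangulation}
  {t : Finset (Sym2 (Fin (2 * n + 4)))} {a b i j k : Fin (2 * n + 4)} {c : Option (Fin n)}

namespace IsTriangulation

variable (ht : K.IsTriangulation t)

include ht

lemma exists_triangle_of_not_isEdge (hij : i ≠ j) (h : ¬ IsEdge t s(i, j)) :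
    ∃ a b, sbtw i a j ∧ sbtw i j b ∧ IsEdge t s(i, a) ∧ IsEdge t s(a, b) ∧ IsEdge t s(b, i) := by
  obtain ⟨s, hs, hs'⟩ := exists_isSide_sbtw i
  have hsj : sbtw i s j := hs' j hij.symm fun hjs => h (hjs ▸ Or.inr hs)
  obtain ⟨a, ha, hia, hlast⟩ := exists_last_sbtw (fun y => IsEdge t s(i, y)) hsj (Or.inr hs)
  obtain ⟨b, hb, hab, hbi, -⟩ := ht.exists_apex hia.swap ha.cyclic_left
  have hbj : j ≠ b := fun hbj => h (hbj ▸ hbi.swap)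
  refine ⟨a, b, ha, ?_, hia, hab, hbi⟩
  rcases sbtw_left_or_right_of_ne ha.cyclic_left hb hbj.symm with hb' | hb'
  · exact absurd hbi.swap (hlast b hb')
  · exact hb'.cyclic_right

lemma exists_flipsTo_of_not_isEdge (hij : i ≠ j) (h : ¬ IsEdge t s(i, j)) :
    ∃ a b k, sbtw i a j ∧ sbtw i j b ∧ sbtw a k b ∧ K.FlipsTo t s(a, b) s(i, k) := by
  obtain ⟨a, b, ha, hb, hia, hab, hbi⟩ := ht.exists_triangle_of_not_isEdge hij h
  have hajb : sbtw a j b := sbtw_shift ha hb.cyclic_left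
  have hbia : sbtw b i a := (ha.trans_right hb).cyclic_right
  have habt : s(a, b) ∈ t := hab.resolve_right (Interleaved.isDiagonal (Or.inl ⟨hajb, hbia⟩)).2
  obtain ⟨k, hk, hak, hkb, -⟩ := ht.exists_apex hab hajb
  exact ⟨a, b, k, ha, hb, hk, flipsTo_iff.2
    ⟨habt, a, k, b, i, rfl, Sym2.eq_swap, hk, hbia, hak, hkb, hbi, hia⟩⟩

lemma eq_of_subset {t' : Finset (Sym2 (Fin (2 * n + 4)))} (ht' : K.IsTriangulation t')
    (h : t ⊆ t') : t = t' :=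
  h.antisymm fun e he =>
    ht.maximal e (ht'.isDiagonal e he) fun f hf => ht'.not_crosses e he f (h hf)

end IsTriangulation

/-- `T'` is obtained from `T` by a sequence of flips of arbitrary colors. -/
def Reaches (T T' : K.ColoredTriangulation) : Prop :=
  Relation.ReflTransGen (fun a b => ∃ c, Flip c a b) T T'

lemma Reaches.refl (T : K.ColoredTriangulation) : Reaches T T := Relation.ReflTransGen.refl

lemma Reaches.trans (h : Reaches T T') (h' : Reaches T' T'') : Reaches T T'' :=
  Relation.ReflTransGen.trans h h'

lemma Flip.reaches (h : Flip c T T') : Reaches T T' := Relation.ReflTransGen.single ⟨c, h⟩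

lemma Reaches.symm (h : Reaches T T') : Reaches T' T := by
  have : Std.Symm fun a b : K.ColoredTriangulation => ∃ c, Flip c a b :=
    ⟨fun a b ⟨c, h'⟩ => ⟨c, h'.symm⟩⟩
  exact Relation.ReflTransGen.stdSymm.symm _ _ h

/-- The other ends of the diagonals at the vertex `0`. -/
def spokes (T : K.ColoredTriangulation) : Set (Fin (2 * n + 4)) := {y | s(0, y) ∈ T.diagonals}

lemma inter_spokes_ssubset_flip {S : Set (Fin (2 * n + 4))}
    (h : K.FlipsTo T.diagonals s(a, b) s(0, k)) (hk : k ∈ S)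
    (hS : ∀ y ∈ S, s(0, y) ≠ s(a, b) ∧ s(0, y) ≠ opposite s(a, b)) :
    S ∩ spokes T ⊂ S ∩ spokes (T.flip h) := by
  refine Set.ssubset_iff_exists.2 ⟨fun y ⟨hyS, hyT⟩ => ⟨hyS, ?_⟩, k, ⟨hk, mem_flipSet_self⟩, ?_⟩
  · exact fixedSet_subset_flipSet (mem_fixedSet.2 ⟨hyT, hS y hyS⟩)
  · exact fun hkT => T.isTriangulation.notMem_of_flipsTo h hkT.2

lemma exists_flipsTo_spoke (hj : (j : ℕ) ∈ Set.Icc 2 (n + 2)) (hjT : j ∉ spokes T) :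
    ∃ a b k : Fin (2 * n + 4), 0 < a ∧ a < j ∧ j < b ∧ a < k ∧ k < b ∧
      K.FlipsTo T.diagonals s(a, b) s(0, k) := by
  rw [Set.mem_Icc] at hj
  have h0 : ((0 : Fin (2 * n + 4)) : ℕ) = 0 := Fin.val_zero _
  have hj' : ¬ IsEdge T.diagonals s(0, j) := by
    rw [IsEdge, isSide_iff]
    exact not_or.2 ⟨hjT, by omega⟩
  obtain ⟨a, b, k, ha, hb, hk, hf⟩ :=
    T.isTriangulation.exists_flipsTo_of_not_isEdge (by omega) hj'
  rw [Fin.sbtw_iff] at ha hb hk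
  exact ⟨a, b, k, by omega, by omega, by omega, by omega, by omega, hf⟩

lemma exists_reaches_central (T : K.ColoredTriangulation) :
    ∃ T', Reaches T T' ∧ antipode 0 ∈ spokes T' := by
  have h0 : ((0 : Fin (2 * n + 4)) : ℕ) = 0 := Fin.val_zero _
  have hN := val_antipode_zero (n := n)
  have step (T : K.ColoredTriangulation) (_ : True) (hT : antipode 0 ∉ spokes T) :
      ∃ T', (∃ c, Flip c T T') ∧ True ∧ Set.univ ∩ spokes T < Set.univ ∩ spokes T' := by
    obtain ⟨a, b, k, h0a, haN, hNb, -, -, hf⟩ :=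
      exists_flipsTo_spoke (by rw [Set.mem_Icc]; omega) hT
    refine ⟨T.flip hf, ⟨_, flip_flip hf⟩, trivial,
      inter_spokes_ssubset_flip hf (Set.mem_univ k) fun y _ => ?_⟩
    have ha' := antipode_val_cases a
    have hb' := antipode_val_cases b
    simp only [opposite_mk, Ne, Sym2.eq_iff, Fin.ext_iff]
    omega
  obtain ⟨T', hT', -, h⟩ := exists_reflTransGen_of_wellFoundedGT _ step T trivial
  exact ⟨T', hT', h⟩

lemma exists_flip_ssubset_spokes (hT : antipode 0 ∈ spokes T)
    (hfan : ¬ ∀ c, fanVertex c ∈ spokes T) :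
    ∃ T', (∃ c, Flip c T T') ∧ antipode 0 ∈ spokes T' ∧
      Set.Iic (antipode 0) ∩ spokes T < Set.Iic (antipode 0) ∩ spokes T' := by
  obtain ⟨c, hc⟩ := not_forall.1 hfan
  have h0 : ((0 : Fin (2 * n + 4)) : ℕ) = 0 := Fin.val_zero _
  have hN := val_antipode_zero (n := n)
  have hcmem := val_fanVertex_mem c
  obtain ⟨a, b, k, h0a, hac, hcb, hak, hkb, hf⟩ := exists_flipsTo_spoke hcmem hc
  rw [Set.mem_Icc] at hcmem
  have hbN : b ≤ antipode 0 := by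
    by_contra! hNb
    refine T.isTriangulation.not_interleaved (Or.inl hT) (Or.inl hf.1) (Or.inl ?_)
    rw [Fin.sbtw_iff, Fin.sbtw_iff]
    omega
  have hlt := inter_spokes_ssubset_flip hf (S := Set.Iic (antipode 0)) (hkb.le.trans hbN)
    fun y hy => by
      have ha' := antipode_val_cases a
      have hb' := antipode_val_cases b
      rw [Set.mem_Iic] at hy
      simp only [opposite_mk, Ne, Sym2.eq_iff, Fin.ext_iff]
      omega
  exact ⟨T.flip hf, ⟨_, flip_flip hf⟩, (hlt.1 ⟨Set.self_mem_Iic, hT⟩).2, hlt⟩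

lemma exists_reaches_spokes (T : K.ColoredTriangulation) :
    ∃ T', Reaches T T' ∧ ∀ c, fanVertex c ∈ spokes T' := by
  obtain ⟨T₁, hT₁, hcentral⟩ := exists_reaches_central T
  obtain ⟨T₂, hT₂, -, h⟩ := exists_reflTransGen_of_wellFoundedGT _
    (fun _ => exists_flip_ssubset_spokes) T₁ hcentral
  exact ⟨T₂, hT₁.trans hT₂, h⟩

end SymmetricPolygon

/-! ### Interchanging two colors in a pentagon -/

namespace SymmetricPolygon

open ColoredTriangulation

variable {n : ℕ} {K : SymmetricPolygon n} {T T' : K.ColoredTriangulation}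
  {a b o p q r u : Fin (2 * n + 4)} {x y : Fin n}

/-- The pentagon `opqru` formed by three triangles of `T`, which is divided by the diagonals `oq` of
color `x` and `or` of color `y`. It lies in the half polygon bounded by the central diagonal at `0`,
so that its image under the central symmetry does not interfere with flips inside it. -/
structure IsPentagon (T : K.ColoredTriangulation) (o p q r u : Fin (2 * n + 4)) (x y : Fin n) :
    Prop where
  opq : sbtw o p q
  oqr : sbtw o q r
  oru : sbtw o r u
  le : o ≤ antipode 0 ∧ p ≤ antipode 0 ∧ q ≤ antipode 0 ∧ r ≤ antipode 0 ∧ u ≤ antipode 0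
  op : IsEdge T.diagonals s(o, p)
  pq : IsEdge T.diagonals s(p, q)
  qr : IsEdge T.diagonals s(q, r)
  ru : IsEdge T.diagonals s(r, u)
  uo : IsEdge T.diagonals s(u, o)
  oq : T.HasColor s(o, q) (some x)
  or : T.HasColor s(o, r) (some y)

lemma ne_opposite_of_le_antipode_zero (hoq : T.HasColor s(o, q) (some x)) (ho : o ≤ antipode 0)
    (hq : q ≤ antipode 0) (ha : a ≤ antipode 0) (hb : b ≤ antipode 0) :
    s(a, b) ≠ opposite s(o, q) := by
  have hcentral : q ≠ antipode o := by
    rw [Ne, ← isCentral_iff (K := K), ← color_eq_none_iff_isCentral hoq.1, hoq.2]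
    exact Option.some_ne_none x
  have hdiag : o ≠ q := mt Sym2.mk_isDiag_iff.2 (T.isTriangulation.isDiagonal _ hoq.1).1
  have hN := val_antipode_zero (n := n)
  have ho' := antipode_val_cases o
  have hq' := antipode_val_cases q
  simp only [opposite_mk, Ne, Sym2.eq_iff, Fin.ext_iff] at *
  omega

namespace IsPentagon

lemma mem_fixedSet (h : IsPentagon T o p q r u x y) (ha : a ≤ antipode 0) (hb : b ≤ antipode 0)
    (hne : s(a, b) ≠ s(o, q)) (hab : s(a, b) ∈ T.diagonals) :
    s(a, b) ∈ fixedSet T.diagonals s(o, q) :=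
  SymmetricPolygon.mem_fixedSet.2
    ⟨hab, hne, ne_opposite_of_le_antipode_zero h.oq h.le.1 h.le.2.2.1 ha hb⟩

lemma exists_flip (h : IsPentagon T o p q r u x y) :
    ∃ T', Reaches T T' ∧ IsPentagon T' r u o p q y x ∧
      ∀ a b c, a ≤ antipode 0 → b ≤ antipode 0 → s(a, b) ≠ s(o, q) → T.HasColor s(a, b) c →
        T'.HasColor s(a, b) c := by
  obtain ⟨ho, hp, hq, hr, hu⟩ := h.le
  have hquad : IsQuad T.diagonals o p q r :=
    ⟨h.opq, h.oqr.cyclic_left, h.op, h.pq, h.qr, IsEdge.swap (Or.inl h.or.1)⟩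
  have hflip : K.FlipsTo T.diagonals s(o, q) s(p, r) :=
    flipsTo_iff.2 ⟨h.oq.1, o, p, q, r, rfl, rfl, hquad⟩
  have hedge {a b} (ha : a ≤ antipode 0) (hb : b ≤ antipode 0) (hne : s(a, b) ≠ s(o, q))
      (hab : IsEdge T.diagonals s(a, b)) : IsEdge (T.flip hflip).diagonals s(a, b) :=
    hab.imp_left fun hab => fixedSet_subset_flipSet (h.mem_fixedSet ha hb hne hab)
  have hquad' := hquad.fixedSet.mono (t' := (T.flip hflip).diagonals) fixedSet_subset_flipSet
  have hne : s(o, r) ≠ s(o, q) ∧ s(r, u) ≠ s(o, q) ∧ s(u, o) ≠ s(o, q) := by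
    have hoqr := h.oqr
    have horu := h.oru
    simp only [Fin.sbtw_iff, Ne, Sym2.eq_iff] at hoqr horu ⊢
    omega
  refine ⟨T.flip hflip, (flip_flip hflip).reaches, ?_, fun a b c ha hb hne hab =>
    hasColor_flip_of_mem_fixedSet hflip (h.mem_fixedSet ha hb hne hab.1) hab⟩
  exact
    { opq := h.oru.cyclic_left
      oqr := (h.opq.trans_right h.oqr).cyclic_right
      oru := (sbtw_shift h.opq h.oqr.cyclic_left).cyclic_right
      le := ⟨hr, hu, ho, hp, hq⟩
      op := hedge hr hu hne.2.1 h.ru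
      pq := hedge hu ho hne.2.2 h.uo
      qr := hquad'.ij
      ru := hquad'.jk
      uo := hquad'.kl
      oq := by
        rw [Sym2.eq_swap (a := r)]
        exact hasColor_flip_of_mem_fixedSet hflip (h.mem_fixedSet ho hr hne.1 h.or.1) h.or
      or := by
        rw [Sym2.eq_swap (a := r)]
        exact ⟨mem_flipSet_self, (color_flip_self hflip).trans h.oq.2⟩ }

/-- Each of the five flips rotates the pentagon; after five of them the triangulation is the old
one, but the two diagonals have exchanged their roles. -/
lemma exists_swap (h : IsPentagon T o p q r u x y) :
    ∃ T', Reaches T T' ∧ IsPentagon T' o p q r u y x ∧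
      ∀ z c, z ≤ antipode 0 → z ≠ q → z ≠ r → T.HasColor s(o, z) c → T'.HasColor s(o, z) c := by
  obtain ⟨T₁, hT₁, h₁, hkeep₁⟩ := h.exists_flip
  obtain ⟨T₂, hT₂, h₂, hkeep₂⟩ := h₁.exists_flip
  obtain ⟨T₃, hT₃, h₃, hkeep₃⟩ := h₂.exists_flip
  obtain ⟨T₄, hT₄, h₄, hkeep₄⟩ := h₃.exists_flip
  obtain ⟨T₅, hT₅, h₅, hkeep₅⟩ := h₄.exists_flip
  refine ⟨T₅, (((hT₁.trans hT₂).trans hT₃).trans hT₄).trans hT₅, h₅, fun z c hz hzq hzr hc => ?_⟩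
  have ho := h.le.1
  have hop : o ≠ p := ne_of_sbtw h.opq
  have hoq : o ≠ q := ne_of_sbtw h.oqr
  have hor : o ≠ r := ne_of_sbtw h.oru
  have hou : o ≠ u := (ne_of_sbtw h.oru.cyclic_right).symm
  refine hkeep₅ o z c ho hz ?_ <| hkeep₄ o z c ho hz ?_ <| hkeep₃ o z c ho hz ?_ <|
    hkeep₂ o z c ho hz ?_ <| hkeep₁ o z c ho hz ?_ hc <;>
  rw [Ne, Sym2.eq_iff] <;> tauto

end IsPentagon

/-! ### Connectedness of the exchange graph -/

/-- `T` contains the diagonals of the standard fan, with colors permuted by `σ`. -/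
def IsFan (T : K.ColoredTriangulation) (σ : Equiv.Perm (Fin n)) : Prop :=
  ∀ c, T.HasColor (fanDiagonal c) (c.map σ)

lemma exists_isFan (h : ∀ c, fanVertex c ∈ spokes T) : ∃ σ, IsFan T σ := by
  have hsome (m : Fin n) : ∃ m', T.color (fanDiagonal (some m)) = some m' := by
    have hm : fanDiagonal (some m) ∈ T.diagonals := h (some m)
    rw [← Option.ne_none_iff_exists', Ne, color_eq_none_iff_isCentral hm, isCentral_fanDiagonal_iff]
    exact Option.some_ne_none m
  choose f hf using hsome
  have hf_inj : Function.Injective f := fun m m' hm => by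
    have hcolor : T.color (fanDiagonal (some m)) = T.color (fanDiagonal (some m')) := by
      rw [hf, hf, hm]
    exact Option.some_injective _ (fanDiagonal_unique (Or.inl rfl)
      (eq_or_eq_opposite_of_color_eq (h (some m)) (h (some m')) hcolor))
  refine ⟨Equiv.ofBijective f (Finite.injective_iff_bijective.1 hf_inj), fun c => ⟨h c, ?_⟩⟩
  cases c with
  | none => exact (color_eq_none_iff_isCentral (h none)).2 (isCentral_fanDiagonal_iff.2 rfl)
  | some m => exact hf m

namespace IsFan

variable {σ : Equiv.Perm (Fin n)}

lemma isEdge (hT : IsFan T σ) {j : Fin (2 * n + 4)} (hj : (j : ℕ) ∈ Set.Icc 1 (n + 2)) :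
    IsEdge T.diagonals s(0, j) := by
  rw [Set.mem_Icc] at hj
  rcases hj.1.eq_or_lt with hj1 | hj1
  · exact Or.inr (isSide_iff.2 (Or.inl (by rw [Fin.val_zero, ← hj1])))
  · obtain ⟨c, rfl⟩ := exists_fanVertex_eq ⟨hj1, hj.2⟩
    exact Or.inl (hT c).1

lemma eq_fan (hT : IsFan T 1) : T = fan K := by
  have hsub : fanSet n ⊆ T.diagonals := by
    intro e he
    obtain ⟨c, rfl | rfl⟩ := mem_fanSet.1 he
    · exact (hT c).1
    · exact T.symmetric _ (hT c).1
  have heq : fanSet n = T.diagonals := isTriangulation_fanSet.eq_of_subset T.isTriangulation hsub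
  refine ext_of_mem heq.symm fun e he => ?_
  obtain ⟨c, hc⟩ := mem_fanSet.1 (heq ▸ he)
  have hTc : T.color (fanDiagonal c) = c := (hT c).2.trans Option.map_id'
  refine Eq.trans ?_ (fanColor_eq hc).symm
  rcases hc with rfl | rfl
  · exact hTc
  · rw [color_opposite, hTc]

lemma exists_isPentagon (hT : IsFan T σ) {m m' : Fin n} (hm : (m' : ℕ) = m + 1) :
    ∃ p u, IsPentagon T 0 p (fanVertex (some m)) (fanVertex (some m')) u (σ m) (σ m') := by
  have hN := val_antipode_zero (n := n)
  have hq := val_fanVertex_some m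
  have hr := val_fanVertex_some m'
  have h0 : ((0 : Fin (2 * n + 4)) : ℕ) = 0 := Fin.val_zero _
  refine ⟨⟨m + 1, by omega⟩, ⟨m + 4, by omega⟩, ?_⟩
  exact
    { opq := by rw [Fin.sbtw_iff]; simp only [Fin.lt_def]; omega
      oqr := by rw [Fin.sbtw_iff]; simp only [Fin.lt_def]; omega
      oru := by rw [Fin.sbtw_iff]; simp only [Fin.lt_def]; omega
      le := by simp only [Fin.le_def]; omega
      op := hT.isEdge (by rw [Set.mem_Icc]; simp only; omega)
      pq := Or.inr (isSide_iff.2 (by simp only; omega))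
      qr := Or.inr (isSide_iff.2 (by omega))
      ru := Or.inr (isSide_iff.2 (by simp only; omega))
      uo := (hT.isEdge (by rw [Set.mem_Icc]; simp only; omega)).swap
      oq := hT (some m)
      or := hT (some m') }

lemma exists_swap (hT : IsFan T σ) {m m' : Fin n} (hm : (m' : ℕ) = m + 1) :
    ∃ T', Reaches T T' ∧ IsFan T' (σ * Equiv.swap m m') := by
  obtain ⟨p, u, hpent⟩ := hT.exists_isPentagon hm
  obtain ⟨T', hreach, hpent', hkeep⟩ := hpent.exists_swap
  refine ⟨T', hreach, fun c => ?_⟩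
  have hle : fanVertex c ≤ antipode 0 := by
    rw [Fin.le_def, val_antipode_zero]
    exact (val_fanVertex_mem c).2
  by_cases hcm : c = some m
  · subst hcm
    rw [Option.map_some, Equiv.Perm.mul_apply, Equiv.swap_apply_left]
    exact hpent'.oq
  by_cases hcm' : c = some m'
  · subst hcm'
    rw [Option.map_some, Equiv.Perm.mul_apply, Equiv.swap_apply_right]
    exact hpent'.or
  have hmap : c.map (σ * Equiv.swap m m') = c.map σ := by
    refine Option.map_congr fun k hk => ?_
    rw [Equiv.Perm.mul_apply, Equiv.swap_apply_of_ne_of_ne] <;> rintro rfl <;> contradiction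
  rw [hmap]
  exact hkeep _ _ hle (fanVertex_injective.ne hcm) (fanVertex_injective.ne hcm') (hT c)

end IsFan

lemma closure_swap_consecutive (n : ℕ) :
    Submonoid.closure {τ : Equiv.Perm (Fin n) | ∃ m m' : Fin n, (m' : ℕ) = m + 1 ∧
      Equiv.swap m m' = τ} = ⊤ := by
  cases n with
  | zero => exact Subsingleton.elim _ _
  | succ n =>
    rw [eq_top_iff, ← Equiv.Perm.mclosure_swap_castSucc_succ n]
    refine Submonoid.closure_mono (Set.range_subset_iff.2 fun i => ?_)
    exact ⟨i.castSucc, i.succ, Fin.val_succ i, rfl⟩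

lemma IsFan.exists_mul {σ : Equiv.Perm (Fin n)} (hT : IsFan T σ) (τ : Equiv.Perm (Fin n)) :
    ∃ T', Reaches T T' ∧ IsFan T' (σ * τ) := by
  have hτ := closure_swap_consecutive n ▸ Submonoid.mem_top τ
  induction hτ using Submonoid.closure_induction generalizing T σ with
  | mem τ hτ =>
    obtain ⟨m, m', hm, rfl⟩ := hτ
    exact hT.exists_swap hm
  | one => exact ⟨T, Reaches.refl T, hT⟩
  | mul τ τ' _ _ ih ih' =>
    obtain ⟨T₁, hT₁, h₁⟩ := ih hT
    obtain ⟨T₂, hT₂, h₂⟩ := ih' h₁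
    exact ⟨T₂, hT₁.trans hT₂, h₂⟩

lemma reaches_fan (T : K.ColoredTriangulation) : Reaches T (fan K) := by
  obtain ⟨T₁, hT₁, hspokes⟩ := exists_reaches_spokes T
  obtain ⟨σ, hσ⟩ := exists_isFan hspokes
  obtain ⟨T₂, hT₂, h₂⟩ := hσ.exists_mul σ⁻¹
  rw [mul_inv_cancel] at h₂
  exact h₂.eq_fan ▸ hT₁.trans hT₂

lemma exists_hasColor (c : Option (Fin n)) (T : K.ColoredTriangulation) : ∃ d, T.HasColor d c := by
  have hfan : ∃ d, (fan K).HasColor d c :=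
    ⟨fanDiagonal c, mem_fanSet.2 ⟨c, Or.inl rfl⟩, fanColor_eq (Or.inl rfl)⟩
  have hT : Reaches (fan K) T := (reaches_fan T).symm
  induction hT with
  | refl => exact hfan
  | tail _ hflip ih =>
    obtain ⟨c', hflip⟩ := hflip
    obtain ⟨d, hd⟩ := ih
    by_cases hc : c = c'
    · obtain ⟨d, d', h, hd, rfl⟩ := flip_iff.1 hflip
      exact ⟨d', mem_flipSet_self, (color_flip_self h).trans (hd.trans hc.symm)⟩
    · exact ⟨d, hflip.hasColor hd hc⟩

instance isColorfulGraph_flip (K : SymmetricPolygon n) :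
    IsColorfulGraph
      (Flip : Option (Fin n) → K.ColoredTriangulation → K.ColoredTriangulation → Prop) where
  exists_rel c T := (exists_hasColor c T).choose_spec.exists_flip
  unique := Flip.unique
  symm := Flip.symm
  notMem := Flip.notMem_faceSet
  connected T T' := (reaches_fan T).trans (reaches_fan T').symm

end SymmetricPolygon

theorem theorem6p2 (n : ℕ) (K : SymmetricPolygon n) :
    ∃ rank : K.ColorfulCyclohedron → ℤ,
      IsAbstractPolytope K.ColorfulCyclohedron (n + 1) rank ∧
      IsSimplePolytope K.ColorfulCyclohedron (n + 1) rank ∧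
      (∀ (C : Finset (Option (Fin n))) (t : K.ColoredTriangulation),
        rank (SymmetricPolygon.face C t) = C.card) ∧
      ∃ φ : K.exchangeGraph ≃g oneSkeleton rank,
        ∀ t : K.ColoredTriangulation, (φ t).1.1 = {t} := by
  have hcard : Fintype.card (Option (Fin n)) = n + 1 := by
    rw [Fintype.card_option, Fintype.card_fin]
  have : Nonempty K.ColoredTriangulation := ⟨SymmetricPolygon.fan K⟩
  let R := SymmetricPolygon.Flip (K := K)
  exact ⟨ColorFace.rank, hcard ▸ ColorFace.isAbstractPolytope R,
    hcard ▸ ColorFace.isSimplePolytope R, fun _ _ => ColorFace.rank_of,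
    ColorFace.oneSkeletonIso R, ColorFace.oneSkeletonIso_apply R⟩
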